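/- Let $p_1,p_2,\ldots$ be real numbers with $0\le p_i<1/2$ for all $i\ge 1$, and let $X_0=0,X_1,X_2,\ldots$ be a Markov chain on $\{0,1,2,\ldots\}$ which steps from $0$ to $1$ with probability $1$ and from $i\ge 1$ to $i+1$ with probability $1/2+p_i$ and to $i-1$ with probability $1/2-p_i$. A site $R$ is called a cutpoint if for some $k$ we have $X_k=R$, $X_i\le R$ for all $0\le i\le k$, and $X_i>R$ for all $i>k$; it is called a strong cutpoint if for some $k$ we have $X_k=R$, $X_i<R$ for all $0\le i<k$, and $X_i>R$ for all $i>k$. Let $\beta$ be a real number. (i) If $\beta>1$ and $$p_k\le \frac14\left(\frac1k+\frac1{k(\log\log k)^\beta}\right)$$ for all sufficiently large $k$, then almost surely the chain has only finitely many cutpoints. (ii) If $\beta\le 1$ and $$p_k\ge \frac14\left(\frac1k+\frac1{k(\log\log k)^\beta}\right)$$ for all sufficiently large $k$, then almost surely the chain has infinitely many strong cutpoints. -/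

import Mathlib

open MeasureTheory Filter

noncomputable section

namespace NNWalk

/-- The upward step probability `E_i` of the walk with drifts `p`: it is `1` at `0` (reflection)
and `1/2 + p i` at `i ≥ 1`. The value `p 0` is never used. -/
def upProb (p : ℕ → ℝ) (i : ℕ) : ℝ := if i = 0 then 1 else 1 / 2 + p i

/-- One-step transition probability from `i` to `j`: up with probability `E_i`, down with
probability `1 - E_i`, anything else with probability `0`. -/
def trans (p : ℕ → ℝ) (i j : ℕ) : ℝ :=
  if j = i + 1 then upProb p i else if j + 1 = i then 1 - upProb p i else 0

/-- `X` is, under `μ`, a nearest neighbor random walk with drifts `p`: a time-homogeneous Markov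
chain on `ℕ` started at `0` with transition probabilities `trans p`. The Markov property is
stated for cylinder events, in multiplied-out form (so that nothing is said about conditioning on
null events). -/
structure IsNNWalk {Ω : Type*} [MeasurableSpace Ω] (μ : Measure Ω) (p : ℕ → ℝ)
    (X : ℕ → Ω → ℕ) : Prop where
  measurable : ∀ n, Measurable (X n)
  start : ∀ᵐ ω ∂μ, X 0 ω = 0
  step : ∀ (n : ℕ) (x : ℕ → ℕ) (j : ℕ),
    μ {ω | (∀ i ≤ n, X i ω = x i) ∧ X (n + 1) ω = j} =
      μ {ω | ∀ i ≤ n, X i ω = x i} * ENNReal.ofReal (trans p (x n) j)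

/-- The site `R` is a cutpoint of the trajectory `x`. -/
def IsCutpoint (x : ℕ → ℕ) (R : ℕ) : Prop :=
  ∃ k, x k = R ∧ (∀ i ≤ k, x i ≤ R) ∧ ∀ i > k, R < x i

/-- The site `R` is a strong cutpoint of the trajectory `x`. -/
def IsStrongCutpoint (x : ℕ → ℕ) (R : ℕ) : Prop :=
  ∃ k, x k = R ∧ (∀ i < k, x i < R) ∧ ∀ i > k, R < x i

/-- The critical drift `(1/4) (1/k + 1/(k (log log k)^β))`, meaningful for `k ≥ 3`, where
`log log k > 0`. -/
def critDrift (β : ℝ) (k : ℕ) : ℝ :=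
  1 / 4 * (1 / (k : ℝ) + 1 / ((k : ℝ) * Real.log (Real.log (k : ℝ)) ^ β))

end NNWalk

end

noncomputable section

namespace NNWalk

/-! Write `s` for `scale p R n` and `ρ` for `oddsProd p R n`, where `S = R + n` and `n > 0`.
Gambler's ruin gives `escape p R` as the reciprocal of the supremum of the scale based at `R` (zero
if unbounded). Since every positive site is almost surely reached, such a site `S` is a strong
cutpoint with probability `upProb p S * escape p S`. The Markov property gives a two-point law
(`measure_cutSet_inter_strong`): given a cutpoint at `R`, and even given that it is the first one
beyond some `a`, the site `S` is a strong cutpoint with probability `upProb p S * (escape p S + ρ /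
s)`. Thus `ρ / s` is the only correlation.

Sites are counted with weight `1 / log S`, which makes the correlation sum over `S` of order one.

For small drifts `escape p S` is at most `6 / (S (log log S)^β)`, so the expected weight of
cutpoints beyond `a` is at most the tail of a convergent series when `β > 1`. A first cutpoint at a
large `R` forces an expected weight of at least `1/64` in `(R, 2R]`. Hence the probability of any
cutpoint beyond `a` tends to zero.

For large drifts `escape p S` is at least `1 / (4 S log log S)`, so the expected weight `Λ` of
strong cutpoints in `[a, b)` diverges like `log log log b`. Given the first strong cutpoint beyond
`a`, the expected weight is at most `Λ + C`, with `C` bounded. So a strong cutpoint beyond `a`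
exists with probability at least `Λ / (Λ + C)`, which tends to one as `b` grows. Only first moments
are used, applied at the first cutpoint. -/

/-- The drifts are admissible: `0 ≤ p i < 1/2` at every site `i ≥ 1`. -/
def Admissible (p : ℕ → ℝ) : Prop := ∀ i, 1 ≤ i → 0 ≤ p i ∧ p i < 1 / 2

/-- The one-step averaging operator of the walk. -/
def avg (p f : ℕ → ℝ) (i : ℕ) : ℝ := upProb p i * f (i + 1) + (1 - upProb p i) * f (i - 1)

/-- The odds of a downward step at `i`. -/
def odds (p : ℕ → ℝ) (i : ℕ) : ℝ := (1 - upProb p i) / upProb p i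

/-- The product of the odds over the `n` sites after `R`. -/
def oddsProd (p : ℕ → ℝ) (R n : ℕ) : ℝ := ∏ i ∈ Finset.range n, odds p (R + 1 + i)

/-- The scale function of the walk based at `R`: it vanishes at `R` and is harmonic above `R`. -/
def scale (p : ℕ → ℝ) (R n : ℕ) : ℝ := ∑ j ∈ Finset.range n, oddsProd p R j

/-! ### Harmonic functions and the scale of the walk -/

section Potential

variable {p : ℕ → ℝ}

lemma Admissible.half_le (hp : Admissible p) (i : ℕ) : 1 / 2 ≤ upProb p i := by
  unfold upProb
  split_ifs with h
  · norm_num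
  · linarith [(hp i (by omega)).1]

lemma Admissible.pos (hp : Admissible p) (i : ℕ) : 0 < upProb p i := by
  linarith [hp.half_le i]

lemma Admissible.le_one (hp : Admissible p) (i : ℕ) : upProb p i ≤ 1 := by
  unfold upProb
  split_ifs with h
  · norm_num
  · linarith [(hp i (by omega)).2]

lemma Admissible.lt_one (hp : Admissible p) {i : ℕ} (hi : 1 ≤ i) : upProb p i < 1 := by
  unfold upProb
  rw [if_neg (by omega)]
  linarith [(hp i hi).2]

lemma avg_mono (hp : Admissible p) {f g : ℕ → ℝ} (h : ∀ i, f i ≤ g i) (i : ℕ) :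
    avg p f i ≤ avg p g i := by
  unfold avg
  have h1 := hp.pos i
  have h2 := hp.le_one i
  have h3 : 0 ≤ 1 - upProb p i := by linarith
  gcongr <;> apply h

lemma avg_nonneg (hp : Admissible p) {f : ℕ → ℝ} (h : ∀ i, 0 ≤ f i) (i : ℕ) :
    0 ≤ avg p f i := by
  have h3 : 0 ≤ 1 - upProb p i := by linarith [hp.le_one i]
  exact add_nonneg (mul_nonneg (hp.pos i).le (h _)) (mul_nonneg h3 (h _))

lemma avg_one (i : ℕ) : avg p (fun _ => 1) i = 1 := by
  simp [avg]

/-- At `R = 0` the truncated `R - 1` is harmless, because the downward weight `1 - upProb p 0`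
vanishes. -/
lemma avg_at_base {f : ℕ → ℝ} {R : ℕ} (h : ∀ i < R, f i = 0) :
    avg p f R = upProb p R * f (R + 1) := by
  rcases Nat.eq_zero_or_pos R with rfl | hR
  · simp [avg, upProb]
  · simp [avg, h (R - 1) (by omega)]

lemma odds_pos (hp : Admissible p) {i : ℕ} (hi : 1 ≤ i) : 0 < odds p i :=
  div_pos (by linarith [hp.lt_one hi]) (hp.pos i)

lemma odds_le_one (hp : Admissible p) (i : ℕ) : odds p i ≤ 1 := by
  unfold odds
  rw [div_le_one (hp.pos i)]
  linarith [hp.half_le i]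

lemma oddsProd_zero (R : ℕ) : oddsProd p R 0 = 1 := by simp [oddsProd]

lemma oddsProd_succ (R n : ℕ) :
    oddsProd p R (n + 1) = oddsProd p R n * odds p (R + 1 + n) := by
  simp [oddsProd, Finset.prod_range_succ]

lemma oddsProd_succ' (R n : ℕ) :
    oddsProd p R (n + 1) = odds p (R + 1) * oddsProd p (R + 1) n := by
  unfold oddsProd
  rw [Finset.prod_range_succ', mul_comm]
  simp only [add_zero]
  congr 1
  exact Finset.prod_congr rfl fun i _ => by congr 1; omega

lemma oddsProd_pos (hp : Admissible p) (R n : ℕ) : 0 < oddsProd p R n :=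
  Finset.prod_pos fun i _ => odds_pos hp (by omega)

lemma oddsProd_le_one (hp : Admissible p) (R n : ℕ) : oddsProd p R n ≤ 1 :=
  Finset.prod_le_one (fun i _ => (odds_pos hp (by omega)).le) fun i _ => odds_le_one hp _

lemma scale_zero (R : ℕ) : scale p R 0 = 0 := by simp [scale]

lemma scale_one (R : ℕ) : scale p R 1 = 1 := by simp [scale, oddsProd]

lemma scale_succ (R n : ℕ) : scale p R (n + 1) = scale p R n + oddsProd p R n := by
  simp [scale, Finset.sum_range_succ]

lemma scale_succ' (R n : ℕ) : scale p R (n + 1) = 1 + odds p (R + 1) * scale p (R + 1) n := by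
  unfold scale
  rw [Finset.sum_range_succ', oddsProd_zero, add_comm, Finset.mul_sum]
  simp only [oddsProd_succ']

lemma scale_add (R n k : ℕ) :
    scale p R (n + k) = scale p R n + oddsProd p R n * scale p (R + n) k := by
  unfold scale
  rw [Finset.sum_range_add, Finset.mul_sum]
  congr 1
  refine Finset.sum_congr rfl fun j _ => ?_
  unfold oddsProd
  rw [Finset.prod_range_add]
  congr 1
  exact Finset.prod_congr rfl fun i _ => by congr 1; omega

lemma scale_mono (hp : Admissible p) (R : ℕ) : Monotone (scale p R) :=
  monotone_nat_of_le_succ fun n => by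
    rw [scale_succ]; linarith [oddsProd_pos hp R n]

lemma scale_nonneg (hp : Admissible p) (R n : ℕ) : 0 ≤ scale p R n :=
  Finset.sum_nonneg fun j _ => (oddsProd_pos hp R j).le

lemma one_le_scale (hp : Admissible p) (R : ℕ) {n : ℕ} (hn : 1 ≤ n) : 1 ≤ scale p R n := by
  rw [← scale_one (p := p) R]; exact scale_mono hp R hn

lemma scale_le (hp : Admissible p) (R n : ℕ) : scale p R n ≤ n := by
  calc scale p R n ≤ ∑ _j ∈ Finset.range n, (1 : ℝ) :=
        Finset.sum_le_sum fun j _ => oddsProd_le_one hp R j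
    _ = n := by simp

/-- A function vanishing at `R` and harmonic on the next sites is a multiple of the scale. -/
lemma eq_scale_mul (hp : Admissible p) {R N : ℕ} {g : ℕ → ℝ} (h0 : g R = 0)
    (hg : ∀ i, R < i → i < R + N → g i = avg p g i) :
    ∀ n ≤ N, g (R + n) = scale p R n * g (R + 1) := by
  have key : ∀ n, n + 1 ≤ N → g (R + n) = scale p R n * g (R + 1) ∧
      g (R + (n + 1)) = scale p R (n + 1) * g (R + 1) := by
    intro n
    induction n with
    | zero => intro _; simp [h0, scale_zero, scale_one]
    | succ n ih =>
      intro hn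
      obtain ⟨h1, h2⟩ := ih (by omega)
      refine ⟨h2, ?_⟩
      have h3 := hg (R + (n + 1)) (by omega) (by omega)
      have hE := (hp.pos (R + (n + 1))).ne'
      have h4 : R + (n + 1) - 1 = R + n := by omega
      have h5 : oddsProd p R (n + 1) * upProb p (R + (n + 1)) =
          oddsProd p R n * (1 - upProb p (R + (n + 1))) := by
        rw [oddsProd_succ, odds, show R + 1 + n = R + (n + 1) by omega]
        field_simp
      unfold avg at h3
      rw [h4, h1, h2, scale_succ] at h3
      apply mul_left_cancel₀ hE
      rw [show R + (n + 1 + 1) = R + (n + 1) + 1 by omega, scale_succ, scale_succ]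
      linear_combination -h3 - g (R + 1) * h5
  intro n hn
  cases n with
  | zero => simp [h0, scale_zero]
  | succ n => exact (key n hn).2

lemma scale_harmonic (hp : Admissible p) (R : ℕ) {i : ℕ} (hi : R < i) :
    avg p (fun j => scale p R (j - R)) i = scale p R (i - R) := by
  obtain ⟨n, rfl⟩ : ∃ n, i = R + (n + 1) := ⟨i - R - 1, by omega⟩
  have hE := (hp.pos (R + (n + 1))).ne'
  have h5 : oddsProd p R (n + 1) * upProb p (R + (n + 1)) =
      oddsProd p R n * (1 - upProb p (R + (n + 1))) := by
    rw [oddsProd_succ, odds, show R + 1 + n = R + (n + 1) by omega]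
    field_simp
  unfold avg
  simp only
  rw [show R + (n + 1) + 1 - R = n + 1 + 1 by omega, show R + (n + 1) - 1 - R = n by omega,
    show R + (n + 1) - R = n + 1 by omega, scale_succ, scale_succ]
  linear_combination h5

/-! ### Staying above a level -/

/-- The probability, starting from `i`, that the next `m` positions are all above `R`. -/
def stay (p : ℕ → ℝ) (R : ℕ) : ℕ → ℕ → ℝ
  | 0 => fun _ => 1
  | m + 1 => avg p fun j => if R < j then stay p R m j else 0

lemma stay_nonneg (hp : Admissible p) (R m i : ℕ) : 0 ≤ stay p R m i := by
  induction m generalizing i with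
  | zero => simp [stay]
  | succ m ih =>
    refine avg_nonneg hp (fun j => ?_) i
    split_ifs
    · exact ih j
    · exact le_rfl

lemma stay_succ_le (hp : Admissible p) (R m i : ℕ) : stay p R (m + 1) i ≤ stay p R m i := by
  induction m generalizing i with
  | zero =>
    refine (avg_mono hp (g := fun _ => 1) (fun j => ?_) i).trans (avg_one i).le
    split_ifs <;> simp [stay]
  | succ m ih =>
    refine avg_mono hp (fun j => ?_) i
    split_ifs
    · exact ih j
    · exact le_rfl

lemma stay_le_one (hp : Admissible p) (R m i : ℕ) : stay p R m i ≤ 1 := by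
  induction m with
  | zero => simp [stay]
  | succ m ih => exact (stay_succ_le hp R m i).trans ih

/-- The probability, starting from `i`, that all later positions are above `R`. -/
def stayForever (p : ℕ → ℝ) (R i : ℕ) : ℝ := ⨅ m, stay p R m i

/-- The probability of never returning to `R` from `R + 1`. -/
def escape (p : ℕ → ℝ) (R : ℕ) : ℝ := stayForever p R (R + 1)

lemma tendsto_stay (hp : Admissible p) (R i : ℕ) :
    Tendsto (fun m => stay p R m i) atTop (nhds (stayForever p R i)) :=
  tendsto_atTop_ciInf (antitone_nat_of_succ_le fun m => stay_succ_le hp R m i)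
    ⟨0, by rintro _ ⟨m, rfl⟩; exact stay_nonneg hp R m i⟩

lemma stayForever_nonneg (hp : Admissible p) (R i : ℕ) : 0 ≤ stayForever p R i :=
  ge_of_tendsto' (tendsto_stay hp R i) fun m => stay_nonneg hp R m i

lemma stayForever_le_one (hp : Admissible p) (R i : ℕ) : stayForever p R i ≤ 1 :=
  le_of_tendsto' (tendsto_stay hp R i) fun m => stay_le_one hp R m i

lemma stayForever_eq (hp : Admissible p) (R i : ℕ) :
    stayForever p R i = avg p (fun j => if R < j then stayForever p R j else 0) i := by
  refine tendsto_nhds_unique ((tendsto_add_atTop_iff_nat 1).2 (tendsto_stay hp R i)) ?_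
  have h : ∀ j, Tendsto (fun m => if R < j then stay p R m j else 0) atTop
      (nhds (if R < j then stayForever p R j else 0)) := by
    intro j
    split_ifs
    · exact tendsto_stay hp R j
    · exact tendsto_const_nhds
  exact ((h _).const_mul _).add ((h _).const_mul _)

lemma escape_nonneg (hp : Admissible p) (R : ℕ) : 0 ≤ escape p R := stayForever_nonneg hp _ _

lemma stayForever_self (hp : Admissible p) (R : ℕ) :
    stayForever p R R = upProb p R * escape p R := by
  rw [stayForever_eq hp, avg_at_base]
  · simp [escape]
  · intro i hi; rw [if_neg (by omega)]

/-- The probability of staying above `R` forever, set to zero at `R`, is harmonic above `R`. So it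
is the scale times its value at `R + 1`, and it is at most one. -/
lemma scale_mul_escape_le (hp : Admissible p) (R n : ℕ) : scale p R n * escape p R ≤ 1 := by
  have h := eq_scale_mul hp (R := R) (N := n)
    (g := fun j => if R < j then stayForever p R j else 0) (by simp) ?_ n le_rfl
  · simp only [Nat.lt_add_one, if_true] at h
    rw [escape, ← h]
    split_ifs
    · exact stayForever_le_one hp _ _
    · norm_num
  · intro i hi _
    simp only [hi, if_true]
    exact stayForever_eq hp R i

/-- Comparison principle: `scale / B` is harmonic above `R`, zero at `R` and at most one, so it
stays below every `stay p R m`. -/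
lemma inv_le_escape (hp : Admissible p) {R : ℕ} {B : ℝ} (hB : ∀ n, scale p R n ≤ B) :
    B⁻¹ ≤ escape p R := by
  have hB0 : 0 < B := by
    have := hB 1
    rw [scale_one] at this
    linarith
  have key : ∀ m i, R < i → scale p R (i - R) / B ≤ stay p R m i := by
    intro m
    induction m with
    | zero => intro i _; rw [stay, div_le_one hB0]; exact hB _
    | succ m ih =>
      intro i hi
      rw [← scale_harmonic hp R hi]
      have : avg p (fun j => scale p R (j - R)) i / B =
          avg p (fun j => scale p R (j - R) / B) i := by unfold avg; ring
      rw [this]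
      refine avg_mono hp (fun j => ?_) i
      split_ifs with hj
      · exact ih j hj
      · rw [Nat.sub_eq_zero_of_le (by omega), scale_zero, zero_div]
  refine ge_of_tendsto' (tendsto_stay hp R (R + 1)) fun m => ?_
  have := key m (R + 1) (by omega)
  rwa [Nat.add_sub_cancel_left, scale_one, one_div] at this

/-- The escape probabilities at two levels determine each other. -/
lemma oddsProd_mul_escape (hp : Admissible p) (R n : ℕ) :
    oddsProd p R n * escape p R = escape p (R + n) * (1 - scale p R n * escape p R) := by
  have hρ := oddsProd_pos hp R n
  have heR := escape_nonneg hp R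
  have heS := escape_nonneg hp (R + n)
  -- Formally this is `scale_add` with `k → ∞`, rewritten in reciprocals. To avoid infinite suprema,
  -- each inequality converts `scale_mul_escape_le` at one base into a bound on the scale at the
  -- other, then applies `inv_le_escape`; a vanishing escape probability is treated apart.
  apply le_antisymm
  · rcases heR.eq_or_lt with h | h
    · rw [← h]; simpa using heS
    · have hb : ∀ k, scale p (R + n) k ≤
          (1 - scale p R n * escape p R) / (oddsProd p R n * escape p R) := by
        intro k
        rw [le_div_iff₀ (by positivity)]
        have := scale_mul_escape_le hp R (n + k)
        rw [scale_add] at this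
        linarith
      have h1 := hb 1
      rw [scale_one, le_div_iff₀ (by positivity)] at h1
      have h0 : 0 < oddsProd p R n * escape p R := by positivity
      have h2 := inv_le_escape hp hb
      rw [inv_div, div_le_iff₀ (by linarith)] at h2
      exact h2
  · rcases heS.eq_or_lt with h | h
    · rw [← h, zero_mul]; positivity
    · have hb : ∀ k, scale p R k ≤ scale p R n + oddsProd p R n / escape p (R + n) := by
        intro k
        refine (scale_mono hp R (Nat.le_add_left k n)).trans ?_
        rw [scale_add]
        gcongr
        rw [le_div_iff₀ h]
        have := scale_mul_escape_le hp (R + n) k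
        nlinarith
      have h2 := inv_le_escape hp hb
      have h3 : 0 < scale p R n + oddsProd p R n / escape p (R + n) := by
        have := scale_nonneg hp R n
        positivity
      rw [inv_le_iff_one_le_mul₀ h3] at h2
      have h4 : escape p (R + n) * (escape p R * (scale p R n + oddsProd p R n /
        escape p (R + n))) = escape p R * (escape p (R + n) * scale p R n + oddsProd p R n) := by
        field_simp
      nlinarith

/-! ### First visits -/

/-- The probability, starting from `i`, of a first visit to `S` after exactly `m` steps, through
positions in `K`, the starting point included if `m > 0`. -/
def firstHit (p : ℕ → ℝ) (K : Set ℕ) [DecidablePred (· ∈ K)] (S : ℕ) : ℕ → ℕ → ℝ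
  | 0 => fun i => if i = S then 1 else 0
  | m + 1 => fun i => if i ∈ K then avg p (firstHit p K S m) i else 0

section FirstHit

variable {K : Set ℕ} [DecidablePred (· ∈ K)] {S : ℕ}

lemma firstHit_nonneg (hp : Admissible p) (m i : ℕ) : 0 ≤ firstHit p K S m i := by
  induction m generalizing i with
  | zero => unfold firstHit; split_ifs <;> norm_num
  | succ m ih =>
    unfold firstHit
    split_ifs
    · exact avg_nonneg hp ih i
    · exact le_rfl

/-- Because `S ∉ K`, a start in `K` contributes nothing at `m = 0` and a start outside `K`
contributes only there, so no path is counted twice. -/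
lemma sum_firstHit_le_one (hp : Admissible p) (hS : S ∉ K) (M i : ℕ) :
    ∑ m ∈ Finset.range M, firstHit p K S m i ≤ 1 := by
  induction M generalizing i with
  | zero => simp
  | succ M ih =>
    rw [Finset.sum_range_succ']
    by_cases hi : i ∈ K
    · have hiS : i ≠ S := fun h => hS (h ▸ hi)
      simp only [firstHit, hi, if_true, hiS, if_false, add_zero]
      refine le_trans (le_of_eq ?_) ((avg_mono hp ih i).trans (avg_one i).le)
      simp only [avg, Finset.sum_add_distrib, Finset.mul_sum]
    · simp only [firstHit, hi, if_false, Finset.sum_const_zero, zero_add]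
      split_ifs <;> norm_num

lemma summable_firstHit (hp : Admissible p) (hS : S ∉ K) (i : ℕ) :
    Summable fun m => firstHit p K S m i :=
  summable_of_sum_range_le (fun m => firstHit_nonneg hp m i)
    fun M => sum_firstHit_le_one hp hS M i

variable (p K S) in
/-- The probability, starting from `i`, of reaching `S` through positions in `K`. -/
def hitProb (i : ℕ) : ℝ := ∑' m, firstHit p K S m i

lemma hasSum_avg_firstHit (hp : Admissible p) (hS : S ∉ K) (i : ℕ) :
    HasSum (fun m => avg p (firstHit p K S m) i) (avg p (hitProb p K S) i) :=
  ((summable_firstHit hp hS _).hasSum.mul_left _).add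
    ((summable_firstHit hp hS _).hasSum.mul_left _)

lemma hitProb_of_mem (hp : Admissible p) (hS : S ∉ K) {i : ℕ} (hi : i ∈ K) :
    hitProb p K S i = avg p (hitProb p K S) i := by
  rw [hitProb, (summable_firstHit hp hS i).tsum_eq_zero_add]
  have hiS : i ≠ S := fun h => hS (h ▸ hi)
  simp only [firstHit, hi, if_true, hiS, if_false, zero_add]
  exact (hasSum_avg_firstHit hp hS i).tsum_eq

lemma hitProb_self (hp : Admissible p) (hS : S ∉ K) : hitProb p K S S = 1 := by
  rw [hitProb, (summable_firstHit hp hS S).tsum_eq_zero_add]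
  simp [firstHit, hS]

lemma hitProb_of_notMem (hp : Admissible p) (hS : S ∉ K) {i : ℕ} (hi : i ∉ K) (hiS : i ≠ S) :
    hitProb p K S i = 0 := by
  rw [hitProb, (summable_firstHit hp hS i).tsum_eq_zero_add]
  simp [firstHit, hi, hiS]

end FirstHit

/-- Gambler's ruin: on `[R, S]` the hitting probability is the scale normalized to be one at `S`,
and the first step must go up. -/
lemma avg_hitProb_Ioo (hp : Admissible p) {R S : ℕ} (h : R < S) :
    avg p (hitProb p (Set.Ioo R S) S) R = upProb p R / scale p R (S - R) := by
  have hS : S ∉ Set.Ioo R S := by simp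
  have h0 : ∀ i ≤ R, hitProb p (Set.Ioo R S) S i = 0 := fun i hi =>
    hitProb_of_notMem hp hS (by simp; omega) (by omega)
  have h1 := eq_scale_mul hp (N := S - R) (h0 R le_rfl) (fun i h1 h2 =>
    hitProb_of_mem hp hS ⟨h1, by omega⟩) (S - R) le_rfl
  rw [Nat.add_sub_cancel' h.le, hitProb_self hp hS] at h1
  have h2 := one_le_scale hp R (n := S - R) (by omega)
  rw [avg_at_base fun i hi => h0 i hi.le, eq_div_iff (by positivity)]
  linear_combination -upProb p R * h1

/-- Reflection at `0` equates the values at `0` and `1`, and harmonicity then makes the hitting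
probability constant up to `S`, where it is one. -/
lemma avg_hitProb_Iio (hp : Admissible p) {S : ℕ} (h : 0 < S) :
    avg p (hitProb p (Set.Iio S) S) 0 = 1 := by
  have hS : S ∉ Set.Iio S := by simp
  have key : ∀ n, n < S →
      hitProb p (Set.Iio S) S (n + 1) = hitProb p (Set.Iio S) S n := by
    intro n
    induction n with
    | zero =>
      intro _
      rw [hitProb_of_mem hp hS (i := 0) h]
      simp [avg, upProb]
    | succ n ih =>
      intro hn
      have h1 := hitProb_of_mem hp hS (i := n + 1) hn
      unfold avg at h1
      rw [Nat.add_sub_cancel, ← ih (by omega)] at h1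
      apply mul_left_cancel₀ (hp.pos (n + 1)).ne'
      linarith
  have key2 : ∀ n, n ≤ S → hitProb p (Set.Iio S) S n = hitProb p (Set.Iio S) S 0 := by
    intro n
    induction n with
    | zero => intro _; rfl
    | succ n ih => intro hn; rw [key n hn, ih (by omega)]
  rw [← hitProb_of_mem hp hS (i := 0) h, ← key2 S le_rfl, hitProb_self hp hS]

end Potential

/-! ### The Markov property on path space -/

/-- A set of paths that is determined by the positions up to time `n`. -/
def IsPast (n : ℕ) (A : Set (ℕ → ℕ)) : Prop :=
  ∀ x y : ℕ → ℕ, (∀ i ≤ n, x i = y i) → x ∈ A → y ∈ A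

lemma IsPast.mono {n m : ℕ} {A : Set (ℕ → ℕ)} (h : IsPast n A) (hnm : n ≤ m) : IsPast m A :=
  fun x y hxy => h x y fun i hi => hxy i (hi.trans hnm)

lemma IsPast.inter {n : ℕ} {A B : Set (ℕ → ℕ)} (hA : IsPast n A) (hB : IsPast n B) :
    IsPast n (A ∩ B) :=
  fun x y hxy hx => ⟨hA x y hxy hx.1, hB x y hxy hx.2⟩

lemma isPast_coord {n i : ℕ} (hi : i ≤ n) (s : Set ℕ) : IsPast n {x | x i ∈ s} :=
  fun x y hxy hx => by
    have : x i ∈ s := hx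
    rw [hxy i hi] at this
    exact this

/-- Extend a finite path by zeros. -/
def extendZero (n : ℕ) (y : Fin (n + 1) → ℕ) (i : ℕ) : ℕ :=
  if h : i < n + 1 then y ⟨i, h⟩ else 0

/-- The first `n + 1` positions of a path. -/
def restrictTo (n : ℕ) (x : ℕ → ℕ) (i : Fin (n + 1)) : ℕ := x i

lemma measurable_restrictTo (n : ℕ) : Measurable (restrictTo n) :=
  measurable_pi_lambda _ fun i => measurable_pi_apply (i : ℕ)

lemma extendZero_restrictTo (n : ℕ) (x : ℕ → ℕ) {i : ℕ} (hi : i ≤ n) :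
    extendZero n (restrictTo n x) i = x i := by
  simp [extendZero, restrictTo, Nat.lt_succ_of_le hi]

lemma IsPast.mem_iff {n : ℕ} {A : Set (ℕ → ℕ)} (hA : IsPast n A) (x : ℕ → ℕ) :
    x ∈ A ↔ extendZero n (restrictTo n x) ∈ A :=
  ⟨hA _ _ fun _ hi => (extendZero_restrictTo n x hi).symm,
    hA _ _ fun _ hi => extendZero_restrictTo n x hi⟩

lemma IsPast.measurableSet {n : ℕ} {A : Set (ℕ → ℕ)} (hA : IsPast n A) : MeasurableSet A := by
  have : A = restrictTo n ⁻¹' {y | extendZero n y ∈ A} := by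
    ext x; exact hA.mem_iff x
  rw [this]
  exact measurable_restrictTo n (MeasurableSet.of_discrete)

lemma measurableSet_coord (i : ℕ) (s : Set ℕ) : MeasurableSet {x : ℕ → ℕ | x i ∈ s} :=
  (isPast_coord le_rfl s).measurableSet

lemma measure_eq_tsum_fiber {Ω ι : Type*} [MeasurableSpace Ω] [Countable ι] [MeasurableSpace ι]
    [MeasurableSingletonClass ι] (μ : Measure Ω) {f : Ω → ι} (hf : Measurable f) {E : Set Ω}
    (hE : MeasurableSet E) : μ E = ∑' i, μ (E ∩ f ⁻¹' {i}) := by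
  rw [← measure_iUnion _ fun i => hE.inter (hf (measurableSet_singleton i))]
  · congr 1
    ext ω
    simp
  · intro i j hij
    refine Set.disjoint_left.2 fun ω h1 h2 => hij ?_
    exact h1.2.symm.trans h2.2

section Walk

variable {p : ℕ → ℝ} {P : Measure (ℕ → ℕ)}

/-- A past event is a countable disjoint union of cylinders over finite paths, to each of which the
defining step property applies. -/
lemma measure_past_step (hP : IsNNWalk P p fun n x => x n) {n s : ℕ} {A : Set (ℕ → ℕ)}
    (hA : IsPast n A) (hs : ∀ x ∈ A, x n = s) (j : ℕ) :
    P (A ∩ {x | x (n + 1) = j}) = P A * ENNReal.ofReal (trans p s j) := by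
  have hj : MeasurableSet {x : ℕ → ℕ | x (n + 1) = j} := measurableSet_coord (n + 1) {j}
  rw [measure_eq_tsum_fiber P (measurable_restrictTo n) (hA.measurableSet.inter hj),
    measure_eq_tsum_fiber P (measurable_restrictTo n) hA.measurableSet, ← ENNReal.tsum_mul_right]
  refine tsum_congr fun y => ?_
  have hfib : ∀ x : ℕ → ℕ, restrictTo n x = y ↔ ∀ i ≤ n, x i = extendZero n y i := by
    intro x
    constructor
    · rintro rfl i hi; exact (extendZero_restrictTo n x hi).symm
    · intro h
      ext i
      have := h i (Nat.lt_succ_iff.1 i.2)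
      simpa [extendZero, restrictTo, Nat.lt_succ_iff.1 i.2] using this
  by_cases hy : extendZero n y ∈ A
  · have h1 : A ∩ {x | x (n + 1) = j} ∩ restrictTo n ⁻¹' {y} =
        {x | (∀ i ≤ n, x i = extendZero n y i) ∧ x (n + 1) = j} := by
      ext x
      simp only [Set.mem_inter_iff, Set.mem_ofPred_eq, Set.mem_preimage, Set.mem_singleton_iff,
        hfib]
      constructor
      · rintro ⟨⟨_, h2⟩, h3⟩; exact ⟨h3, h2⟩
      · rintro ⟨h3, h2⟩; exact ⟨⟨hA _ _ (fun i hi => (h3 i hi).symm) hy, h2⟩, h3⟩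
    have h2 : A ∩ restrictTo n ⁻¹' {y} = {x | ∀ i ≤ n, x i = extendZero n y i} := by
      ext x
      simp only [Set.mem_inter_iff, Set.mem_ofPred_eq, Set.mem_preimage, Set.mem_singleton_iff,
        hfib]
      exact ⟨fun h => h.2, fun h => ⟨hA _ _ (fun i hi => (h i hi).symm) hy, h⟩⟩
    rw [h1, h2, hP.step n (extendZero n y) j, hs _ hy]
  · have h2 : A ∩ restrictTo n ⁻¹' {y} = ∅ := by
      ext x
      simp only [Set.mem_inter_iff, Set.mem_preimage, Set.mem_singleton_iff,
        Set.mem_empty_iff_false, iff_false, not_and]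
      rintro hx rfl
      exact hy ((hA.mem_iff x).1 hx)
    have h1 : A ∩ {x | x (n + 1) = j} ∩ restrictTo n ⁻¹' {y} = ∅ := by
      rw [Set.inter_right_comm, h2, Set.empty_inter]
    rw [h1, h2, measure_empty, zero_mul]

lemma tsum_trans_mul (hp : Admissible p) {f : ℕ → ℝ} (hf : ∀ i, 0 ≤ f i) (s : ℕ) :
    ∑' j, ENNReal.ofReal (trans p s j) * ENNReal.ofReal (f j) =
      ENNReal.ofReal (avg p f s) := by
  have h3 : 0 ≤ 1 - upProb p s := by linarith [hp.le_one s]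
  rw [tsum_eq_sum (s := {s + 1, s - 1})]
  · rw [Finset.sum_pair (by omega), avg, ENNReal.ofReal_add
      (mul_nonneg (hp.pos s).le (hf _)) (mul_nonneg h3 (hf _)),
      ENNReal.ofReal_mul (hp.pos s).le, ENNReal.ofReal_mul h3]
    congr 2
    · simp [trans]
    · rcases Nat.eq_zero_or_pos s with rfl | h
      · simp [trans, upProb]
      · rw [trans, if_neg (by omega), if_pos (by omega)]
  · intro j hj
    simp only [Finset.mem_insert, Finset.mem_singleton, not_or] at hj
    rw [trans, if_neg hj.1, if_neg (by omega)]
    simp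

/-- First-step analysis after a past event ending at `s`. -/
lemma measure_first_step (hp : Admissible p) (hP : IsNNWalk P p fun n x => x n) {n s : ℕ}
    {A E : Set (ℕ → ℕ)} (hA : IsPast n A) (hs : ∀ x ∈ A, x n = s) (hE : MeasurableSet E)
    {f : ℕ → ℝ} (hf : ∀ i, 0 ≤ f i)
    (h : ∀ j, P ((A ∩ {x | x (n + 1) = j}) ∩ E) =
      P (A ∩ {x | x (n + 1) = j}) * ENNReal.ofReal (f j)) :
    P (A ∩ E) = P A * ENNReal.ofReal (avg p f s) := by
  rw [measure_eq_tsum_fiber P (measurable_pi_apply (n + 1)) (hA.measurableSet.inter hE),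
    ← tsum_trans_mul hp hf, ← ENNReal.tsum_mul_left]
  refine tsum_congr fun j => ?_
  rw [← mul_assoc, ← measure_past_step hP hA hs j, ← h j, Set.inter_right_comm]
  rfl

/-- The next `m` positions after time `n` lie in `K`. -/
def within (K : Set ℕ) (n m : ℕ) : Set (ℕ → ℕ) := {x | ∀ i, n < i → i ≤ n + m → x i ∈ K}

lemma isPast_within (K : Set ℕ) (n m : ℕ) : IsPast (n + m) (within K n m) :=
  fun _ _ hxy hx i h1 h2 => hxy i h2 ▸ hx i h1 h2

lemma within_zero (K : Set ℕ) (n : ℕ) : within K n 0 = Set.univ := by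
  ext x; simp only [within, Set.mem_ofPred_eq, Set.mem_univ, iff_true]; intros; omega

lemma mem_within_succ {K : Set ℕ} {n m : ℕ} {x : ℕ → ℕ} :
    x ∈ within K n (m + 1) ↔ x (n + 1) ∈ K ∧ x ∈ within K (n + 1) m := by
  constructor
  · intro h
    exact ⟨h _ (by omega) (by omega), fun i h1 h2 => h i (by omega) (by omega)⟩
  · rintro ⟨h1, h2⟩ i h3 h4
    rcases Nat.lt_or_ge (n + 1) i with h | h
    · exact h2 i h (by omega)
    · obtain rfl : i = n + 1 := by omega
      exact h1

lemma isPast_inter_coord {n : ℕ} {A : Set (ℕ → ℕ)} (hA : IsPast n A) (j : ℕ) :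
    IsPast (n + 1) (A ∩ {x | x (n + 1) = j}) :=
  (hA.mono n.le_succ).inter (isPast_coord le_rfl {j})

/-- The induction ranges over all past events, since `A` together with the next position is the past
event for the following step. -/
lemma measure_within (hp : Admissible p) (hP : IsNNWalk P p fun n x => x n) (R : ℕ) (m : ℕ) :
    ∀ {n s : ℕ} {A : Set (ℕ → ℕ)}, IsPast n A → (∀ x ∈ A, x n = s) →
      P (A ∩ within (Set.Ioi R) n m) = P A * ENNReal.ofReal (stay p R m s) := by
  induction m with
  | zero => intro n s A _ _; simp [within_zero, stay]
  | succ m ih =>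
    intro n s A hA hs
    refine measure_first_step hp hP hA hs (isPast_within _ _ _).measurableSet (fun j => ?_)
      fun j => ?_
    · split_ifs
      · exact stay_nonneg hp R m j
      · exact le_rfl
    · split_ifs with hj
      · rw [← ih (isPast_inter_coord hA j) fun x hx => hx.2]
        congr 1
        ext x
        simp only [Set.mem_inter_iff, mem_within_succ, Set.mem_ofPred_eq, Set.mem_Ioi]
        grind
      · rw [ENNReal.ofReal_zero, mul_zero]
        convert measure_empty (μ := P)
        ext x
        simp only [Set.mem_inter_iff, mem_within_succ, Set.mem_ofPred_eq, Set.mem_Ioi,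
          Set.mem_empty_iff_false, iff_false]
        grind

/-- All positions after time `n` are above `R`. -/
def above (R n : ℕ) : Set (ℕ → ℕ) := {x | ∀ i, n < i → R < x i}

lemma above_eq_iInter (R n : ℕ) : above R n = ⋂ m, within (Set.Ioi R) n m := by
  ext x
  simp only [above, within, Set.mem_iInter, Set.mem_ofPred_eq, Set.mem_Ioi]
  exact ⟨fun h m i h1 _ => h i h1, fun h i h1 => h i i h1 (by omega)⟩

lemma measurableSet_above (R n : ℕ) : MeasurableSet (above R n) := by
  rw [above_eq_iInter]
  exact MeasurableSet.iInter fun m => (isPast_within _ _ _).measurableSet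

lemma measure_above [IsProbabilityMeasure P] (hp : Admissible p)
    (hP : IsNNWalk P p fun n x => x n) (R : ℕ) {n s : ℕ} {A : Set (ℕ → ℕ)} (hA : IsPast n A)
    (hs : ∀ x ∈ A, x n = s) :
    P (A ∩ above R n) = P A * ENNReal.ofReal (stayForever p R s) := by
  have h1 : Tendsto (fun m => P (A ∩ within (Set.Ioi R) n m)) atTop
      (nhds (P (A ∩ above R n))) := by
    rw [above_eq_iInter, Set.inter_iInter]
    refine tendsto_measure_iInter_atTop
      (fun m => (hA.measurableSet.inter (isPast_within _ _ _).measurableSet).nullMeasurableSet)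
      (fun m k hmk => Set.inter_subset_inter_right _ fun x hx i h1 h2 => hx i h1 (by omega))
      ⟨0, measure_ne_top _ _⟩
  refine tendsto_nhds_unique h1 ?_
  simp_rw [measure_within hp hP R _ hA hs]
  exact ENNReal.Tendsto.const_mul (ENNReal.tendsto_ofReal (tendsto_stay hp R s))
    (Or.inr (measure_ne_top _ _))

/-- The first step is split off by `avg` because the starting site need not lie in `K`; below it is
the endpoint `R` of `Set.Ioo R S`. -/
lemma measure_firstHit (hp : Admissible p) (hP : IsNNWalk P p fun n x => x n) (K : Set ℕ)
    [DecidablePred (· ∈ K)] (S : ℕ) (m : ℕ) :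
    ∀ {n s : ℕ} {A : Set (ℕ → ℕ)}, IsPast n A → (∀ x ∈ A, x n = s) →
      P (A ∩ (within K n m ∩ {x | x (n + m + 1) = S})) =
        P A * ENNReal.ofReal (avg p (firstHit p K S m) s) := by
  induction m with
  | zero =>
    intro n s A hA hs
    refine measure_first_step hp hP hA hs ((isPast_within _ _ _).measurableSet.inter
      (measurableSet_coord _ {S})) (firstHit_nonneg hp 0) fun j => ?_
    simp only [within_zero, Set.univ_inter, firstHit, add_zero]
    split_ifs with hj
    · subst hj; simp [Set.inter_assoc]
    · rw [ENNReal.ofReal_zero, mul_zero]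
      convert measure_empty (μ := P)
      ext x
      simp only [Set.mem_inter_iff, Set.mem_ofPred_eq, Set.mem_empty_iff_false, iff_false]
      grind
  | succ m ih =>
    intro n s A hA hs
    refine measure_first_step hp hP hA hs ((isPast_within _ _ _).measurableSet.inter
      (measurableSet_coord _ {S})) (firstHit_nonneg hp (m + 1)) fun j => ?_
    simp only [firstHit]
    split_ifs with hj
    · rw [← ih (isPast_inter_coord hA j) fun x hx => hx.2]
      congr 1
      ext x
      simp only [Set.mem_inter_iff, mem_within_succ, Set.mem_ofPred_eq]
      rw [show n + (m + 1) + 1 = n + 1 + m + 1 by omega]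
      grind
    · rw [ENNReal.ofReal_zero, mul_zero]
      convert measure_empty (μ := P)
      ext x
      simp only [Set.mem_inter_iff, mem_within_succ, Set.mem_ofPred_eq,
          Set.mem_empty_iff_false, iff_false]
      grind

end Walk

/-! ### Cutpoints described by their arrival times -/

/-- A family of past events `T R k`, each requiring the walk to be at its maximum `R` at time
`k`. -/
structure IsArrival (T : ℕ → ℕ → Set (ℕ → ℕ)) : Prop where
  past : ∀ R k, IsPast k (T R k)
  eq : ∀ {R k x}, x ∈ T R k → x k = R
  le : ∀ {R k x}, x ∈ T R k → ∀ i ≤ k, x i ≤ R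

/-- The paths that arrive at `R` in the sense of `T` and are above `R` ever after. -/
def cutSet (T : ℕ → ℕ → Set (ℕ → ℕ)) (R : ℕ) : Set (ℕ → ℕ) := ⋃ k, T R k ∩ above R k

/-- The walk is at its maximum `R` at time `k`. -/
def weakArrival (R k : ℕ) : Set (ℕ → ℕ) := {x | x k = R ∧ ∀ i ≤ k, x i ≤ R}

/-- The walk visits `R` for the first time at time `k`, coming from below. -/
def strongArrival (R k : ℕ) : Set (ℕ → ℕ) := {x | x k = R ∧ ∀ i < k, x i < R}

/-- The arrivals of `T` at `R ≥ a` that do not come after a cutpoint in `[a, R)`. -/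
def firstArrival (T : ℕ → ℕ → Set (ℕ → ℕ)) (a R k : ℕ) : Set (ℕ → ℕ) :=
  T R k ∩ {x | a ≤ R ∧ ∀ R' < R, a ≤ R' →
    ∀ k' < k, x ∈ T R' k' → x ∉ within (Set.Ioi R') k' (k - k')}

lemma isArrival_weak : IsArrival weakArrival where
  past _ k _ _ hxy hx := ⟨hxy k le_rfl ▸ hx.1, fun i hi => hxy i hi ▸ hx.2 i hi⟩
  eq hx := hx.1
  le hx := hx.2

lemma isArrival_strong : IsArrival strongArrival where
  past _ k _ _ hxy hx := ⟨hxy k le_rfl ▸ hx.1, fun i hi => hxy i hi.le ▸ hx.2 i hi⟩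
  eq hx := hx.1
  le hx i hi := by
    rcases hi.lt_or_eq with h | rfl
    · exact (hx.2 i h).le
    · exact hx.1.le

lemma IsArrival.first {T : ℕ → ℕ → Set (ℕ → ℕ)} (hT : IsArrival T) (a : ℕ) :
    IsArrival (firstArrival T a) where
  past R k x y hxy hx := by
    refine ⟨hT.past R k x y hxy hx.1, hx.2.1, fun R' hR' ha k' hk' h1 h2 => ?_⟩
    refine hx.2.2 R' hR' ha k' hk'
      (hT.past R' k' y x (fun i hi => (hxy i (hi.trans hk'.le)).symm) h1) ?_
    exact isPast_within _ _ _ y x (fun i hi => (hxy i (by omega)).symm) h2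
  eq hx := hT.eq hx.1
  le hx := hT.le hx.1

lemma isCutpoint_iff (x : ℕ → ℕ) (R : ℕ) : IsCutpoint x R ↔ x ∈ cutSet weakArrival R := by
  simp only [IsCutpoint, cutSet, weakArrival, above, Set.mem_iUnion, Set.mem_inter_iff,
    Set.mem_ofPred_eq, and_assoc, gt_iff_lt]

lemma isStrongCutpoint_iff (x : ℕ → ℕ) (R : ℕ) :
    IsStrongCutpoint x R ↔ x ∈ cutSet strongArrival R := by
  simp only [IsStrongCutpoint, cutSet, strongArrival, above, Set.mem_iUnion, Set.mem_inter_iff,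
    Set.mem_ofPred_eq, and_assoc, gt_iff_lt]

lemma cutSet_strong_subset (R : ℕ) : cutSet strongArrival R ⊆ cutSet weakArrival R :=
  Set.iUnion_mono fun _ _ hx => ⟨⟨isArrival_strong.eq hx.1, isArrival_strong.le hx.1⟩, hx.2⟩

/-- If the path is above `R > R'` after time `k`, staying above `R'` until time `k` amounts to
staying above it forever. Being the first cutpoint is thus decided at time `k`, so the Markov
property applies there. -/
lemma mem_cutSet_first {T : ℕ → ℕ → Set (ℕ → ℕ)} (hT : IsArrival T) (a R : ℕ) (x : ℕ → ℕ) :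
    x ∈ cutSet (firstArrival T a) R ↔
      a ≤ R ∧ x ∈ cutSet T R ∧ ∀ R' < R, a ≤ R' → x ∉ cutSet T R' := by
  simp only [cutSet, Set.mem_iUnion, firstArrival, Set.mem_inter_iff, Set.mem_ofPred_eq]
  constructor
  · rintro ⟨k, ⟨h1, h2, h3⟩, h4⟩
    refine ⟨h2, ⟨k, h1, h4⟩, ?_⟩
    rintro R' hR' ha ⟨k', h5, h6⟩
    have hxk := hT.eq h1
    have hxk' := hT.eq h5
    have hlt : k' < k := by
      rcases lt_trichotomy k' k with h | h | h
      · exact h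
      · subst h; omega
      · have := h4 k' h; omega
    exact h3 R' hR' ha k' hlt h5 fun i hi _ => h6 i hi
  · rintro ⟨h2, ⟨k, h1, h4⟩, h3⟩
    refine ⟨k, ⟨h1, h2, fun R' hR' ha k' hk' h5 h6 => h3 R' hR' ha ⟨k', h5, fun i hi => ?_⟩⟩, h4⟩
    rcases Nat.lt_or_ge k i with h | h
    · exact hR'.trans (h4 i h)
    · exact h6 i hi (by omega)

lemma IsArrival.measurableSet_cutSet {T : ℕ → ℕ → Set (ℕ → ℕ)} (hT : IsArrival T) (R : ℕ) :
    MeasurableSet (cutSet T R) :=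
  MeasurableSet.iUnion fun k => (hT.past R k).measurableSet.inter (measurableSet_above R k)

lemma pairwise_disjoint_cutSet_first {T : ℕ → ℕ → Set (ℕ → ℕ)} (hT : IsArrival T) (a : ℕ) :
    Pairwise (Function.onFun Disjoint (cutSet (firstArrival T a))) := by
  intro R R' hne
  refine Set.disjoint_left.2 fun x h1 h2 => ?_
  rw [mem_cutSet_first hT] at h1 h2
  rcases lt_or_gt_of_ne hne with h | h
  · exact h2.2.2 R h h1.1 h1.2.1
  · exact h1.2.2 R' h h2.1 h2.2.1

/-- A path with a cutpoint at `S ≥ a` has a first cutpoint in `[a, S]`. -/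
lemma exists_cutSet_first {T : ℕ → ℕ → Set (ℕ → ℕ)} (hT : IsArrival T) {a S : ℕ} (ha : a ≤ S)
    {x : ℕ → ℕ} (hx : x ∈ cutSet T S) : ∃ R, a ≤ R ∧ R ≤ S ∧ x ∈ cutSet (firstArrival T a) R := by
  classical
  have hex : ∃ R, a ≤ R ∧ x ∈ cutSet T R := ⟨S, ha, hx⟩
  refine ⟨Nat.find hex, (Nat.find_spec hex).1, Nat.find_min' hex ⟨ha, hx⟩,
    (mem_cutSet_first hT a _ x).2 ⟨(Nat.find_spec hex).1, (Nat.find_spec hex).2, ?_⟩⟩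
  exact fun R' hR' ha' h => Nat.find_min hex hR' ⟨ha', h⟩

/-! ### One- and two-point probabilities of cutpoints, and the moment bounds -/

section Walk

variable {p : ℕ → ℝ} {P : Measure (ℕ → ℕ)} [IsProbabilityMeasure P]
  {T : ℕ → ℕ → Set (ℕ → ℕ)}

/-- The time witnessing a cutpoint is the last visit to `R`, so the union over `k` is disjoint. -/
lemma measure_cutSet (hp : Admissible p) (hP : IsNNWalk P p fun n x => x n) (hT : IsArrival T)
    (R : ℕ) : P (cutSet T R) =
      (∑' k, P (T R k)) * ENNReal.ofReal (upProb p R * escape p R) := by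
  rw [cutSet, measure_iUnion]
  · rw [← ENNReal.tsum_mul_right]
    refine tsum_congr fun k => ?_
    rw [measure_above hp hP R (hT.past R k) fun x hx => hT.eq hx, stayForever_self hp]
  · have key : ∀ k k' : ℕ, k < k' → ∀ x, x ∈ T R k ∩ above R k → x ∉ T R k' ∩ above R k' := by
      intro k k' h x h1 h2
      have h3 := h1.2 k' h
      have h4 := hT.eq h2.1
      omega
    intro k k' hne
    refine Set.disjoint_left.2 fun x h1 h2 => ?_
    rcases lt_or_gt_of_ne hne with h | h
    · exact key _ _ h x h1 h2
    · exact key _ _ h x h2 h1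
  · exact fun k => (hT.past R k).measurableSet.inter (measurableSet_above R k)

/-- After the last visit to `R` the path crosses `(R, S)` to `S` and then stays above `S`. This
replaces the factor `upProb p R * escape p R` by `upProb p R / s * (upProb p S * escape p S)`, with
`s` the scale at `S - R`. By `oddsProd_mul_escape` the ratio takes the stated form, free of `escape
p R`. -/
lemma measure_cutSet_inter_strong (hp : Admissible p) (hP : IsNNWalk P p fun n x => x n)
    (hT : IsArrival T) {R S : ℕ} (hRS : R < S) :
    P (cutSet T R ∩ cutSet strongArrival S) =
      P (cutSet T R) * ENNReal.ofReal (upProb p S *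
        (escape p S + oddsProd p R (S - R) / scale p R (S - R))) := by
  have hd := one_le_scale hp R (n := S - R) (by omega)
  have hρ := oddsProd_pos hp R (S - R)
  have heR := escape_nonneg hp R
  have heS := escape_nonneg hp S
  have hER := hp.pos R
  have hES := hp.pos S
  have hset : cutSet T R ∩ cutSet strongArrival S = ⋃ q : ℕ × ℕ,
      (T R q.1 ∩ (within (Set.Ioo R S) q.1 q.2 ∩ {x | x (q.1 + q.2 + 1) = S})) ∩
        above S (q.1 + q.2 + 1) := by
    ext x
    simp only [cutSet, Set.mem_inter_iff, Set.mem_iUnion, Prod.exists, strongArrival,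
      Set.mem_ofPred_eq]
    constructor
    · rintro ⟨⟨k, h1, h2⟩, ⟨l, ⟨h3, h4⟩, h5⟩⟩
      have hkl : k < l := by
        by_contra h
        have := hT.le h1 l (by omega)
        omega
      refine ⟨k, l - k - 1, ⟨h1, fun i hi hi' => ⟨h2 i hi, h4 i (by omega)⟩, ?_⟩, ?_⟩
      · rw [show k + (l - k - 1) + 1 = l by omega, h3]
      · rwa [show k + (l - k - 1) + 1 = l by omega]
    · rintro ⟨k, m, ⟨h1, h2, h3⟩, h4⟩
      refine ⟨⟨k, h1, fun i hi => ?_⟩, ⟨k + m + 1, ⟨h3, fun i hi => ?_⟩, h4⟩⟩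
      · rcases lt_trichotomy i (k + m + 1) with h | h | h
        · exact (h2 i hi (by omega)).1
        · subst h; rwa [h3]
        · exact hRS.trans (h4 i h)
      · rcases Nat.lt_or_ge k i with h | h
        · exact (h2 i h (by omega)).2
        · exact (hT.le h1 i h).trans_lt hRS
  have hpast : ∀ q : ℕ × ℕ, IsPast (q.1 + q.2 + 1)
      (T R q.1 ∩ (within (Set.Ioo R S) q.1 q.2 ∩ {x | x (q.1 + q.2 + 1) = S})) := fun q =>
    ((hT.past R q.1).mono (by omega)).inter
      (((isPast_within _ _ _).mono (by omega)).inter (isPast_coord le_rfl {S}))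
  have hS : S ∉ Set.Ioo R S := by simp
  rw [hset, measure_iUnion, ENNReal.tsum_prod (f := fun k m => P (T R k ∩ (within (Set.Ioo R S) k m ∩
    {x | x (k + m + 1) = S}) ∩ above S (k + m + 1))), measure_cutSet hp hP hT]
  · have h1 : ∀ k m, P ((T R k ∩ (within (Set.Ioo R S) k m ∩ {x | x (k + m + 1) = S})) ∩
        above S (k + m + 1)) = P (T R k) * (ENNReal.ofReal
          (avg p (firstHit p (Set.Ioo R S) S m) R) *
          ENNReal.ofReal (upProb p S * escape p S)) := by
      intro k m
      rw [measure_above hp hP S (hpast (k, m)) fun x hx => hx.2.2, stayForever_self hp,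
        measure_firstHit hp hP _ S m (hT.past R k) fun x hx => hT.eq hx, mul_assoc]
    simp_rw [h1, ENNReal.tsum_mul_left, ENNReal.tsum_mul_right]
    rw [mul_assoc, ← ENNReal.ofReal_tsum_of_nonneg
      (fun m => avg_nonneg hp (firstHit_nonneg hp m) R) (hasSum_avg_firstHit hp hS R).summable,
      (hasSum_avg_firstHit hp hS R).tsum_eq, avg_hitProb_Ioo hp hRS,
      ← ENNReal.ofReal_mul (by positivity), ← ENNReal.ofReal_mul (by positivity)]
    congr 2
    have h2 := oddsProd_mul_escape hp R (S - R)
    rw [Nat.add_sub_cancel' hRS.le] at h2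
    field_simp
    linear_combination -h2
  -- The pair is determined by the path: `q.1` is the last visit to `R` and `q.1 + q.2 + 1` the last
  -- visit to `S`.
  · have key : ∀ q q' : ℕ × ℕ, ∀ x, x ∈ (T R q.1 ∩ (within (Set.Ioo R S) q.1 q.2 ∩
        {x | x (q.1 + q.2 + 1) = S})) ∩ above S (q.1 + q.2 + 1) →
        x ∈ (T R q'.1 ∩ (within (Set.Ioo R S) q'.1 q'.2 ∩
        {x | x (q'.1 + q'.2 + 1) = S})) ∩ above S (q'.1 + q'.2 + 1) →
        q'.1 ≤ q.1 ∧ q'.1 + q'.2 ≤ q.1 + q.2 := by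
      rintro ⟨k, m⟩ ⟨k', m'⟩ x ⟨⟨h1, h2, h3⟩, h4⟩ ⟨⟨h1', _, h3'⟩, _⟩
      simp only [Set.mem_ofPred_eq] at *
      constructor
      · by_contra hlt
        have e := hT.eq h1'
        rcases lt_trichotomy k' (k + m + 1) with h | h | h
        · have := (h2 k' (by omega) (by omega)).1; omega
        · rw [h] at e; omega
        · have := h4 k' h; omega
      · by_contra hlt
        have := h4 (k' + m' + 1) (by omega)
        omega
    intro q q' hne
    refine Set.disjoint_left.2 fun x h1 h2 => hne ?_
    have h3 := key q q' x h1 h2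
    have h4 := key q' q x h2 h1
    exact Prod.ext (by omega) (by omega)
  · exact fun q => (hpast q).measurableSet.inter (measurableSet_above _ _)

/-- Times at the maximum `R` may repeat, but the step from there to the new maximum `R + 1` occurs
at most once; the factor `upProb p R` pays for that step. -/
lemma measure_cutSet_weak_le (hp : Admissible p) (hP : IsNNWalk P p fun n x => x n) (R : ℕ) :
    P (cutSet weakArrival R) ≤ ENNReal.ofReal (escape p R) := by
  rw [measure_cutSet hp hP isArrival_weak, ENNReal.ofReal_mul (hp.pos R).le, ← mul_assoc,
    ← ENNReal.tsum_mul_right]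
  refine mul_le_of_le_one_left zero_le ?_
  have h1 : ∀ k, P (weakArrival R k) * ENNReal.ofReal (upProb p R) =
      P (weakArrival R k ∩ {x | x (k + 1) = R + 1}) := by
    intro k
    rw [measure_past_step hP (isArrival_weak.past R k) fun x hx => hx.1]
    simp [trans]
  simp_rw [h1]
  rw [← measure_iUnion]
  · exact prob_le_one
  · have key : ∀ k k' : ℕ, k < k' → ∀ x, x ∈ weakArrival R k ∩ {x | x (k + 1) = R + 1} →
        x ∉ weakArrival R k' ∩ {x | x (k' + 1) = R + 1} := by
      intro k k' h x h1 h2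
      have h3 := h1.2
      have h4 := h2.1.2 (k + 1) (by omega)
      simp only [Set.mem_ofPred_eq] at h3
      omega
    intro k k' hne
    refine Set.disjoint_left.2 fun x h1 h2 => ?_
    rcases lt_or_gt_of_ne hne with h | h
    · exact key _ _ h x h1 h2
    · exact key _ _ h x h2 h1
  · exact fun k => (isArrival_weak.past R k).measurableSet.inter (measurableSet_coord _ {R + 1})

/-- The first arrival at `S` happens almost surely by `avg_hitProb_Iio`, so the arrival
probabilities sum to one. -/
lemma measure_cutSet_strong (hp : Admissible p) (hP : IsNNWalk P p fun n x => x n) {S : ℕ}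
    (h0S : 0 < S) :
    P (cutSet strongArrival S) = ENNReal.ofReal (upProb p S * escape p S) := by
  rw [measure_cutSet hp hP isArrival_strong]
  convert one_mul _
  have hS : S ∉ Set.Iio S := by simp
  have hpast : IsPast 0 {x : ℕ → ℕ | x 0 ∈ ({0} : Set ℕ)} := isPast_coord le_rfl _
  have h1 : ∀ m, P (strongArrival S (m + 1)) =
      ENNReal.ofReal (avg p (firstHit p (Set.Iio S) S m) 0) := by
    intro m
    have h2 := measure_firstHit hp hP (Set.Iio S) S m hpast fun x hx => hx
    have h3 : ∀ᵐ x ∂P, x 0 = 0 := hP.start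
    have h4 : P {x : ℕ → ℕ | x 0 ∈ ({0} : Set ℕ)} = 1 := by
      rw [← measure_univ (μ := P)]
      refine measure_congr ?_
      filter_upwards [h3] with x hx
      exact propext ⟨fun _ => trivial, fun _ => hx⟩
    rw [h4, one_mul] at h2
    rw [← h2]
    refine measure_congr ?_
    filter_upwards [h3] with x hx
    refine propext ⟨fun h => ⟨hx, fun i hi hi' => h.2 i (by omega), ?_⟩, fun h => ⟨?_, ?_⟩⟩
    · have := h.1
      simpa using this
    · have := h.2.2
      simpa using this
    · intro i hi
      rcases Nat.eq_zero_or_pos i with rfl | h5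
      · rwa [hx]
      · exact h.2.1 i h5 (by omega)
  have h0 : P (strongArrival S 0) = 0 := by
    have h3 : ∀ᵐ x ∂P, x 0 = 0 := hP.start
    rw [← measure_empty (μ := P)]
    refine measure_congr ?_
    filter_upwards [h3] with x hx
    refine propext ⟨fun h => ?_, fun h => h.elim⟩
    have := h.1
    omega
  rw [tsum_eq_zero_add' ENNReal.summable, h0, zero_add]
  simp_rw [h1]
  rw [← ENNReal.ofReal_tsum_of_nonneg
      (fun m => avg_nonneg hp (firstHit_nonneg hp m) 0) (hasSum_avg_firstHit hp hS 0).summable,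
      (hasSum_avg_firstHit hp hS 0).tsum_eq, avg_hitProb_Iio hp h0S, ENNReal.ofReal_one]

/-- A first moment bound for cutpoints: after the first cutpoint, many more are expected. -/
lemma measure_exists_cutpoint_le (hp : Admissible p) (hP : IsNNWalk P p fun n x => x n)
    {w : ℕ → ℝ} (hw : ∀ S, 0 ≤ w S) {a : ℕ} {c : ℝ}
    (hc : ∀ R, a ≤ R → c ≤ ∑ S ∈ Finset.Ioc R (2 * R),
      w S * (1 / 2 * (oddsProd p R (S - R) / scale p R (S - R)))) :
    ENNReal.ofReal c * P {x | ∃ R, a ≤ R ∧ x ∈ cutSet weakArrival R} ≤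
      ∑' S, if a ≤ S then ENNReal.ofReal (w S * escape p S) else 0 := by
  set F := cutSet (firstArrival weakArrival a) with hF
  have hFm : ∀ R, MeasurableSet (F R) := (isArrival_weak.first a).measurableSet_cutSet
  have hFe : ∀ R, ¬ a ≤ R → F R = ∅ := by
    intro R hR
    ext x
    simp only [hF, mem_cutSet_first isArrival_weak, hR, false_and, Set.mem_empty_iff_false]
  have h1 : P {x | ∃ R, a ≤ R ∧ x ∈ cutSet weakArrival R} ≤ ∑' R, P (F R) := by
    refine (measure_mono ?_).trans (measure_iUnion_le F)
    rintro x ⟨S, ha, hx⟩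
    obtain ⟨R, _, _, h⟩ := exists_cutSet_first isArrival_weak ha hx
    exact Set.mem_iUnion.2 ⟨R, h⟩
  -- Given a first cutpoint at `R`, only strong cutpoints in `(R, 2R]` are kept, the term `escape p
  -- S` is dropped and `upProb p S ≥ 1/2` is used.
  have h2 : ∀ R, ENNReal.ofReal c * P (F R) ≤
      ∑' S, if a ≤ S then ENNReal.ofReal (w S) * P (F R ∩ cutSet weakArrival S) else 0 := by
    intro R
    by_cases hR : a ≤ R
    · refine le_trans ?_ (ENNReal.sum_le_tsum (Finset.Ioc R (2 * R)))
      refine (mul_le_mul_left (ENNReal.ofReal_le_ofReal (hc R hR)) _).trans ?_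
      have hpos : ∀ S, 0 ≤ 1 / 2 * (oddsProd p R (S - R) / scale p R (S - R)) := fun S => by
        have h3 := (oddsProd_pos hp R (S - R)).le
        have h4 := scale_nonneg hp R (S - R)
        positivity
      rw [ENNReal.ofReal_sum_of_nonneg fun S _ => mul_nonneg (hw S) (hpos S), Finset.sum_mul]
      refine Finset.sum_le_sum fun S hS => ?_
      rw [Finset.mem_Ioc] at hS
      rw [if_pos (by omega), ENNReal.ofReal_mul (hw S), mul_assoc, mul_comm (ENNReal.ofReal _) (P _)]
      gcongr
      refine le_trans ?_ (measure_mono (Set.inter_subset_inter_right _ (cutSet_strong_subset S)))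
      rw [hF, measure_cutSet_inter_strong hp hP (isArrival_weak.first a) hS.1]
      gcongr
      · exact div_nonneg (oddsProd_pos hp _ _).le (scale_nonneg hp _ _)
      · exact (hp.pos S).le
      · exact hp.half_le S
      · linarith [escape_nonneg hp S]
    · rw [hFe R hR]; simp
  calc ENNReal.ofReal c * P {x | ∃ R, a ≤ R ∧ x ∈ cutSet weakArrival R}
      ≤ ∑' R, ENNReal.ofReal c * P (F R) := by
        rw [ENNReal.tsum_mul_left]; gcongr
    _ ≤ ∑' R, ∑' S, if a ≤ S then ENNReal.ofReal (w S) * P (F R ∩ cutSet weakArrival S) else 0 :=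
        ENNReal.tsum_le_tsum h2
    _ = ∑' S, ∑' R, if a ≤ S then ENNReal.ofReal (w S) * P (F R ∩ cutSet weakArrival S) else 0 :=
        ENNReal.tsum_comm
    _ ≤ ∑' S, if a ≤ S then ENNReal.ofReal (w S * escape p S) else 0 := by
        -- The events `F R` are disjoint, so their intersections with a cutpoint at `S` have total
        -- mass at most `escape p S`.
        refine ENNReal.tsum_le_tsum fun S => ?_
        split_ifs
        · rw [ENNReal.tsum_mul_left, ENNReal.ofReal_mul (hw S)]
          gcongr
          rw [← measure_iUnion (fun R R' hne => ?_)
            (fun R => (hFm R).inter (isArrival_weak.measurableSet_cutSet S))]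
          · exact (measure_mono (Set.iUnion_subset fun R => Set.inter_subset_right)).trans
              (measure_cutSet_weak_le hp hP S)
          · exact (pairwise_disjoint_cutSet_first isArrival_weak a hne).mono
              Set.inter_subset_left Set.inter_subset_left
        · simp

/-- A lower bound for the probability of a strong cutpoint in `[a, b)`. -/
lemma le_measure_exists_strongCutpoint (hp : Admissible p) (hP : IsNNWalk P p fun n x => x n)
    {w : ℕ → ℝ} (hw : ∀ S, 0 ≤ w S) {a b : ℕ} (ha : 0 < a) {C : ℝ} (hC0 : 0 ≤ C)
    (hC : ∀ R ∈ Finset.Ico a b, w R + ∑ S ∈ Finset.Ico (R + 1) b,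
      w S * (oddsProd p R (S - R) / scale p R (S - R)) ≤ C) :
    ∑ S ∈ Finset.Ico a b, w S * (upProb p S * escape p S) ≤
      (∑ S ∈ Finset.Ico a b, w S * (upProb p S * escape p S) + C) *
        P.real {x | ∃ R, a ≤ R ∧ x ∈ cutSet strongArrival R} := by
  set Λ := ∑ S ∈ Finset.Ico a b, w S * (upProb p S * escape p S) with hΛ
  set F := cutSet (firstArrival strongArrival a) with hF
  have hFm : ∀ R, MeasurableSet (F R) := (isArrival_strong.first a).measurableSet_cutSet
  have hE : ∀ S, 0 ≤ upProb p S * escape p S := fun S =>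
    mul_nonneg (hp.pos S).le (escape_nonneg hp S)
  have hq : ∀ R S, 0 ≤ oddsProd p R (S - R) / scale p R (S - R) := fun R S =>
    div_nonneg (oddsProd_pos hp _ _).le (scale_nonneg hp _ _)
  have h1 : ∀ S ∈ Finset.Ico a b, upProb p S * escape p S ≤
      ∑ R ∈ Finset.Icc a S, P.real (F R ∩ cutSet strongArrival S) := by
    intro S hS
    rw [Finset.mem_Ico] at hS
    have h2 : P.real (cutSet strongArrival S) = upProb p S * escape p S := by
      rw [Measure.real, measure_cutSet_strong hp hP (ha.trans_le hS.1),
        ENNReal.toReal_ofReal (hE S)]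
    rw [← h2]
    refine (measureReal_mono ?_ (measure_ne_top _ _)).trans (measureReal_biUnion_finset_le _ _)
    intro x hx
    obtain ⟨R, h3, h4, h5⟩ := exists_cutSet_first isArrival_strong hS.1 hx
    simp only [Set.mem_iUnion]
    exact ⟨R, Finset.mem_Icc.2 ⟨h3, h4⟩, h5, hx⟩
  -- By the two-point law, conditioning on a first cutpoint at `R` adds to the mean weight `Λ` at
  -- most the correlations and the weight of `R` itself, which `C` bounds.
  have h2 : ∀ R ∈ Finset.Ico a b, ∑ S ∈ Finset.Ico R b,
      w S * P.real (F R ∩ cutSet strongArrival S) ≤ P.real (F R) * (Λ + C) := by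
    intro R hR
    have hR' := Finset.mem_Ico.1 hR
    rw [Finset.sum_eq_sum_Ico_succ_bot hR'.2]
    have h3 : w R * P.real (F R ∩ cutSet strongArrival R) ≤ P.real (F R) * w R := by
      rw [mul_comm]
      exact mul_le_mul_of_nonneg_right (measureReal_mono Set.inter_subset_left) (hw R)
    have h4 : ∀ S ∈ Finset.Ico (R + 1) b, w S * P.real (F R ∩ cutSet strongArrival S) ≤
        P.real (F R) * (w S * (upProb p S * escape p S) +
          w S * (oddsProd p R (S - R) / scale p R (S - R))) := by
      intro S hS
      rw [Finset.mem_Ico] at hS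
      rw [Measure.real, hF, measure_cutSet_inter_strong hp hP (isArrival_strong.first a)
        (show R < S by omega), ENNReal.toReal_mul, ENNReal.toReal_ofReal
        (mul_nonneg (hp.pos S).le (add_nonneg (escape_nonneg hp S) (hq R S))), ← hF, ← mul_add,
        ← Measure.real, mul_left_comm]
      refine mul_le_mul_of_nonneg_left (mul_le_mul_of_nonneg_left ?_ (hw S)) measureReal_nonneg
      rw [mul_add]
      gcongr
      exact mul_le_of_le_one_left (hq R S) (hp.le_one S)
    refine (add_le_add h3 (Finset.sum_le_sum h4)).trans ?_
    rw [← Finset.mul_sum, ← mul_add, Finset.sum_add_distrib]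
    refine mul_le_mul_of_nonneg_left ?_ measureReal_nonneg
    have h5 : ∑ S ∈ Finset.Ico (R + 1) b, w S * (upProb p S * escape p S) ≤ Λ :=
      Finset.sum_le_sum_of_subset_of_nonneg
        (Finset.Ico_subset_Ico_left (by omega)) fun S _ _ => mul_nonneg (hw S) (hE S)
    linarith [hC R hR]
  calc Λ ≤ ∑ S ∈ Finset.Ico a b, ∑ R ∈ Finset.Icc a S,
        w S * P.real (F R ∩ cutSet strongArrival S) := by
        refine Finset.sum_le_sum fun S hS => ?_
        rw [← Finset.mul_sum]
        exact mul_le_mul_of_nonneg_left (h1 S hS) (hw S)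
    _ = ∑ R ∈ Finset.Ico a b, ∑ S ∈ Finset.Ico R b,
        w S * P.real (F R ∩ cutSet strongArrival S) := by
        refine Finset.sum_comm' fun S R => ?_
        simp only [Finset.mem_Ico, Finset.mem_Icc]
        omega
    _ ≤ ∑ R ∈ Finset.Ico a b, P.real (F R) * (Λ + C) := Finset.sum_le_sum h2
    _ = (Λ + C) * P.real (⋃ R ∈ Finset.Ico a b, F R) := by
        rw [← Finset.sum_mul, mul_comm, measureReal_biUnion_finset
          (fun R _ R' _ hne => pairwise_disjoint_cutSet_first isArrival_strong a hne)
          fun R _ => hFm R]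
    _ ≤ (Λ + C) * P.real {x | ∃ R, a ≤ R ∧ x ∈ cutSet strongArrival R} := by
        have hΛ0 : 0 ≤ Λ := Finset.sum_nonneg fun S _ => mul_nonneg (hw S) (hE S)
        refine mul_le_mul_of_nonneg_left (measureReal_mono ?_) (by positivity)
        refine Set.iUnion₂_subset fun R _ x hx => ?_
        rw [hF, mem_cutSet_first isArrival_strong] at hx
        exact ⟨R, hx.1, hx.2.1⟩

end Walk

/-! ### Elementary estimates -/

lemma sub_div_le_log_sub {a b : ℝ} (ha : 0 < a) (hb : 0 < b) :
    (b - a) / b ≤ Real.log b - Real.log a := by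
  rw [← Real.log_div hb.ne' ha.ne']
  have h := Real.one_sub_inv_le_log_of_pos (div_pos hb ha)
  rw [inv_div] at h
  rwa [sub_div, div_self hb.ne']

lemma log_sub_le_sub_div {a b : ℝ} (ha : 0 < a) (hb : 0 < b) :
    Real.log b - Real.log a ≤ (b - a) / a := by
  rw [← Real.log_div hb.ne' ha.ne', sub_div, div_self ha.ne']
  exact Real.log_le_sub_one_of_pos (div_pos hb ha)

/-- The tangent line at `y` to the convex function `t ^ (-γ)`. -/
lemma rpow_neg_sub_rpow_neg_ge {x y γ : ℝ} (hx : 0 < x) (hy : 0 < y) (hγ : 0 ≤ γ) :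
    γ * ((y - x) * y ^ (-(γ + 1))) ≤ x ^ (-γ) - y ^ (-γ) := by
  have h1 : x ^ (-γ) = y ^ (-γ) * (x / y) ^ (-γ) := by
    rw [← Real.mul_rpow hy.le (div_pos hx hy).le, mul_div_cancel₀ _ hy.ne']
  have h2 : 1 + γ * (1 - x / y) ≤ (x / y) ^ (-γ) := by
    rw [Real.rpow_def_of_pos (div_pos hx hy)]
    have h3 := Real.add_one_le_exp (Real.log (x / y) * -γ)
    have h4 := Real.log_le_sub_one_of_pos (div_pos hx hy)
    nlinarith
  have h5 : (y - x) * y ^ (-(γ + 1)) = y ^ (-γ) * (1 - x / y) := by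
    rw [neg_add, Real.rpow_add hy, Real.rpow_neg_one]
    field_simp
  rw [h5, h1]
  have h6 := mul_le_mul_of_nonneg_left h2 (Real.rpow_nonneg hy.le (-γ))
  linarith

lemma log_log_nat_tendsto : Tendsto (fun n : ℕ => Real.log (Real.log n)) atTop atTop :=
  Real.tendsto_log_atTop.comp (Real.tendsto_log_atTop.comp tendsto_natCast_atTop_atTop)

lemma log_log_mono {m n : ℕ} (hm : 1 < Real.log m) (hmn : m ≤ n) :
    Real.log (Real.log m) ≤ Real.log (Real.log n) := by
  have h0 : (0 : ℝ) < m := by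
    rcases Nat.eq_zero_or_pos m with rfl | h
    · simp at hm; linarith
    · exact_mod_cast h
  have h1 : (m : ℝ) ≤ n := by exact_mod_cast hmn
  exact Real.log_le_log (by linarith) (Real.log_le_log h0 h1)

lemma eventually_large : ∀ᶠ n : ℕ in atTop,
    8 ≤ n ∧ 2 ≤ Real.log n ∧ 1 ≤ Real.log (Real.log n) ∧ 4 * Real.log n ≤ n := by
  have h1 : Tendsto (fun n : ℕ => Real.log n) atTop atTop :=
    Real.tendsto_log_atTop.comp tendsto_natCast_atTop_atTop
  have h2 : ∀ᶠ n : ℕ in atTop, 4 * Real.log n ≤ n := by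
    have h3 := (Real.isLittleO_log_id_atTop.comp_tendsto
      (tendsto_natCast_atTop_atTop (R := ℝ))).bound (c := 1 / 4) (by norm_num)
    filter_upwards [h3, h1.eventually_ge_atTop 0] with n h4 h5
    simp only [Function.comp, id, Real.norm_eq_abs, abs_of_nonneg h5, Nat.abs_cast] at h4
    linarith
  filter_upwards [eventually_ge_atTop 8, h1.eventually_ge_atTop 2,
    log_log_nat_tendsto.eventually_ge_atTop 1, h2] with n a b c d
  exact ⟨a, b, c, d⟩

lemma log_le_sum_inv {x : ℝ} (hx : 0 < x) (n : ℕ) :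
    Real.log (x + n) - Real.log x ≤ ∑ j ∈ Finset.range n, 1 / (x + j) := by
  induction n with
  | zero => simp
  | succ n ih =>
    rw [Finset.sum_range_succ]
    have h := log_sub_le_sub_div (a := x + n) (b := x + (n + 1 : ℕ)) (by positivity)
      (by positivity)
    have h2 : (x + (n + 1 : ℕ) - (x + n)) = 1 := by push_cast; ring
    rw [h2] at h
    linarith

/-- Discrete integral test: the terms are dominated by increments of `-(log log n) ^ (-(β - 1)) / (β
- 1)`. -/
lemma summable_inv_mul_log_mul_log_log_rpow {β : ℝ} (hβ : 1 < β) :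
    Summable fun n : ℕ =>
      1 / ((n : ℝ) * Real.log n * Real.log (Real.log n) ^ β) := by
  obtain ⟨N, hN⟩ := eventually_atTop.1 eventually_large
  set G : ℕ → ℝ := fun n => Real.log (Real.log n) ^ (-(β - 1)) with hG
  have hpos : ∀ n, N ≤ n → 0 < (n : ℝ) ∧ 0 < Real.log n ∧ 0 < Real.log (Real.log n) := by
    intro n hn
    obtain ⟨h1, h2, h3, _⟩ := hN n hn
    refine ⟨?_, by linarith, by linarith⟩
    have : 0 < n := by omega
    exact_mod_cast this
  have hstep : ∀ n, N ≤ n →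
      1 / (((n + 1 : ℕ) : ℝ) * Real.log (n + 1 : ℕ) * Real.log (Real.log (n + 1 : ℕ)) ^ β) ≤
        (G n - G (n + 1)) / (β - 1) := by
    intro n hn
    obtain ⟨a1, a2, a3⟩ := hpos n hn
    obtain ⟨b1, b2, b3⟩ := hpos (n + 1) (by omega)
    have h1 := sub_div_le_log_sub a2 b2
    have h2 := sub_div_le_log_sub a1 b1
    have h3 : ((n + 1 : ℕ) : ℝ) - n = 1 := by push_cast; ring
    rw [h3] at h2
    have h4 : 1 / (((n + 1 : ℕ) : ℝ) * Real.log (n + 1 : ℕ)) ≤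
        Real.log (Real.log (n + 1 : ℕ)) - Real.log (Real.log n) := by
      refine le_trans ?_ h1
      rw [← div_div]
      gcongr
    have h5 := rpow_neg_sub_rpow_neg_ge a3 b3 (γ := β - 1) (by linarith)
    rw [le_div_iff₀ (by linarith), ← div_div]
    refine le_trans ?_ h5
    rw [sub_add_cancel, Real.rpow_neg b3.le, mul_comm, div_eq_mul_inv]
    gcongr
  rw [← summable_nat_add_iff (N + 1)]
  refine summable_of_sum_range_le (c := G N / (β - 1)) (fun k => ?_) fun M => ?_
  · obtain ⟨b1, b2, b3⟩ := hpos (k + (N + 1)) (by omega)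
    positivity
  · have h1 : ∀ M, ∑ k ∈ Finset.range M, 1 / (((k + (N + 1) : ℕ) : ℝ) *
        Real.log (k + (N + 1) : ℕ) * Real.log (Real.log (k + (N + 1) : ℕ)) ^ β) ≤
        (G N - G (N + M)) / (β - 1) := by
      intro M
      induction M with
      | zero => simp
      | succ M ih =>
        rw [Finset.sum_range_succ]
        have h2 := hstep (N + M) (by omega)
        rw [show N + M + 1 = M + (N + 1) by omega] at h2
        have h3 : (G N - G (N + (M + 1))) / (β - 1) = (G N - G (N + M)) / (β - 1) +
          (G (N + M) - G (M + (N + 1))) / (β - 1) := by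
          rw [← add_div, show N + (M + 1) = M + (N + 1) by omega]; ring
        rw [h3]
        exact add_le_add ih h2
    refine (h1 M).trans ?_
    have h4 : 0 ≤ G (N + M) := Real.rpow_nonneg (hpos (N + M) (by omega)).2.2.le _
    have h5 : 0 < β - 1 := by linarith
    gcongr
    linarith

/-! ### Small drifts -/

section SmallDrift

variable {p : ℕ → ℝ}

lemma one_sub_le_odds (hp : Admissible p) {k : ℕ} (hk : 1 ≤ k) : 1 - 4 * p k ≤ odds p k := by
  have h := hp k hk
  rw [odds, le_div_iff₀ (hp.pos k), upProb, if_neg (by omega)]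
  nlinarith [h.1]

/-- The lower bound telescopes exactly in products over `k`. The shift by two absorbs the
second-order error, since `(1 + a/(k-2)) (1 - a/k) = 1 + a(2-a)/((k-2)k)`, which is at least one for
`0 ≤ a ≤ 2`. -/
lemma rpow_le_odds {a : ℝ} (ha : 0 ≤ a) (ha2 : a ≤ 2) {k : ℕ} (hk : 4 ≤ k)
    (h : 1 - a / k ≤ odds p k) : (((k : ℝ) - 3) / (k - 2)) ^ a ≤ odds p k := by
  have hk' : (4 : ℝ) ≤ k := by exact_mod_cast hk
  have h0 : 0 < ((k : ℝ) - 3) / (k - 2) := div_pos (by linarith) (by linarith)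
  have h1 : Real.log (((k : ℝ) - 3) / (k - 2)) ≤ -(1 / (k - 2)) := by
    refine (Real.log_le_sub_one_of_pos h0).trans (le_of_eq ?_)
    have : (k : ℝ) - 2 ≠ 0 := by linarith
    field_simp
    ring
  have h2 : 0 ≤ a / (k - 2) := div_nonneg ha (by linarith)
  have h3 : Real.log (((k : ℝ) - 3) / (k - 2)) * a ≤ -(a / (k - 2)) := by
    calc _ ≤ -(1 / ((k : ℝ) - 2)) * a := by gcongr
      _ = _ := by ring
  rw [Real.rpow_def_of_pos h0]
  refine (Real.exp_le_exp.2 h3).trans (le_trans ?_ h)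
  rw [Real.exp_neg, inv_le_comm₀ (Real.exp_pos _)]
  · refine le_trans ?_ (Real.add_one_le_exp _)
    rw [inv_le_iff_one_le_mul₀ (by rw [sub_pos, div_lt_one] <;> linarith)]
    have h4 : (a / (k - 2) + 1) * (1 - a / k) - 1 = a * (2 - a) / ((k - 2) * k) := by
      have h5 : (k : ℝ) - 2 ≠ 0 := by linarith
      have h6 : (k : ℝ) ≠ 0 := by linarith
      field_simp
      ring
    have h7 : 0 ≤ a * (2 - a) / (((k : ℝ) - 2) * k) :=
      div_nonneg (mul_nonneg ha (by linarith)) (mul_nonneg (by linarith) (by linarith))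
    linarith
  · rw [sub_pos, div_lt_one] <;> linarith

lemma rpow_le_oddsProd (hp : Admissible p) {a : ℝ} (ha : 0 ≤ a) (ha2 : a ≤ 2) {R : ℕ}
    (hR : 3 ≤ R) (h : ∀ k, R < k → 1 - a / k ≤ odds p k) (n : ℕ) :
    (((R : ℝ) - 2) / (R + n - 2)) ^ a ≤ oddsProd p R n := by
  have hR' : (3 : ℝ) ≤ R := by exact_mod_cast hR
  induction n with
  | zero =>
    rw [oddsProd_zero, Nat.cast_zero, add_zero, div_self (by linarith), Real.one_rpow]
  | succ n ih =>
    have hn : (0 : ℝ) ≤ n := n.cast_nonneg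
    have h1 := rpow_le_odds ha ha2 (by omega) (h (R + 1 + n) (by omega))
    have h2 : ((R : ℝ) - 2) / (R + (n + 1 : ℕ) - 2) = ((R : ℝ) - 2) / (R + n - 2) *
        ((((R + 1 + n : ℕ) : ℝ) - 3) / ((R + 1 + n : ℕ) - 2)) := by
      push_cast
      have h3 : (R : ℝ) + n - 2 ≠ 0 := by linarith
      have h4 : (R : ℝ) + (n + 1) - 2 ≠ 0 := by linarith
      have h5 : (R : ℝ) + 1 + n - 2 ≠ 0 := by linarith
      have h6 : (R : ℝ) + 1 + n - 3 = R + n - 2 := by ring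
      rw [h6, div_mul_div_cancel₀ h3]
      congr 1
      ring
    have h7 : 0 ≤ ((R : ℝ) - 2) / (R + n - 2) := div_nonneg (by linarith) (by linarith)
    have h8 : 0 ≤ (((R + 1 + n : ℕ) : ℝ) - 3) / ((R + 1 + n : ℕ) - 2) := by
      push_cast
      exact div_nonneg (by linarith) (by linarith)
    rw [h2, Real.mul_rpow h7 h8, oddsProd_succ]
    exact mul_le_mul ih h1 (Real.rpow_nonneg h8 _) (oddsProd_pos hp R n).le

/-- Up to distance `(S - 2) (exp Λ - 1)` the extra exponent `1/Λ` costs only a factor `exp (-1)`.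
The scale therefore dominates a harmonic sum of size `(S - 2) Λ / e`; `e ≤ 3` and `S - 2 ≥ S/2` give
the constant 6. -/
lemma escape_le_of_odds_ge (hp : Admissible p) {Λ : ℝ} (hΛ : 1 ≤ Λ) {S : ℕ} (hS : 4 ≤ S)
    (h : ∀ k, S < k → 1 - (1 + 1 / Λ) / k ≤ odds p k) :
    escape p S ≤ 6 / (S * Λ) := by
  have hS' : (4 : ℝ) ≤ S := by exact_mod_cast hS
  set n := ⌊((S : ℝ) - 2) * (Real.exp Λ - 1)⌋₊ + 1 with hn
  have he : 1 ≤ Real.exp Λ := Real.one_le_exp (by linarith)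
  have h0 : 0 ≤ ((S : ℝ) - 2) * (Real.exp Λ - 1) := mul_nonneg (by linarith) (by linarith)
  have hΛ1 : 1 / Λ ≤ 1 := by rw [div_le_one] <;> linarith
  have hΛ0 : 0 ≤ 1 / Λ := by positivity
  have hterm : ∀ j ∈ Finset.range n,
      Real.exp (-1) * ((S : ℝ) - 2) * (1 / ((S - 2) + j)) ≤ oddsProd p S j := by
    intro j hj
    have hjn : (j : ℝ) ≤ ((S : ℝ) - 2) * (Real.exp Λ - 1) := by
      rw [← Nat.le_floor_iff h0]
      have := Finset.mem_range.1 hj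
      omega
    have hj0 : (0 : ℝ) ≤ j := j.cast_nonneg
    refine le_trans ?_ (rpow_le_oddsProd hp (by linarith) (by linarith) (by omega) h j)
    have hs : (0 : ℝ) < S - 2 := by linarith
    have hsj : (0 : ℝ) < S + j - 2 := by linarith
    have ht : 0 < ((S : ℝ) - 2) / (S + j - 2) := div_pos hs hsj
    rw [Real.rpow_add ht, Real.rpow_one]
    have h2 : Real.exp (-Λ) ≤ ((S : ℝ) - 2) / (S + j - 2) := by
      rw [le_div_iff₀ hsj, Real.exp_neg, inv_mul_le_iff₀ (Real.exp_pos _)]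
      linarith
    have h3 : Real.exp (-1) ≤ (((S : ℝ) - 2) / (S + j - 2)) ^ (1 / Λ) := by
      refine le_trans (le_of_eq ?_) (Real.rpow_le_rpow (Real.exp_pos _).le h2 hΛ0)
      rw [← Real.exp_mul]
      congr 1
      field_simp
    have h4 : Real.exp (-1) * ((S : ℝ) - 2) * (1 / ((S - 2) + j)) =
        ((S : ℝ) - 2) / (S + j - 2) * Real.exp (-1) := by
      rw [show (S : ℝ) - 2 + j = S + j - 2 by ring]; ring
    rw [h4]
    gcongr
  have hsum : Real.exp (-1) * ((S : ℝ) - 2) * Λ ≤ scale p S n := by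
    refine le_trans ?_ (Finset.sum_le_sum hterm)
    rw [← Finset.mul_sum]
    refine mul_le_mul_of_nonneg_left ?_ (mul_nonneg (Real.exp_pos _).le (by linarith))
    refine le_trans ?_ (log_le_sum_inv (by linarith) n)
    have hfl := (Nat.lt_floor_add_one (((S : ℝ) - 2) * (Real.exp Λ - 1))).le
    have hn' : (n : ℝ) = ⌊((S : ℝ) - 2) * (Real.exp Λ - 1)⌋₊ + 1 := by rw [hn]; push_cast; rfl
    rw [← hn'] at hfl
    have h5 : ((S : ℝ) - 2) * Real.exp Λ ≤ S - 2 + n := by linarith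
    have h6 := Real.log_le_log (mul_pos (by linarith) (Real.exp_pos _)) h5
    rw [Real.log_mul (by linarith) (Real.exp_pos _).ne', Real.log_exp] at h6
    linarith
  have h7 := scale_mul_escape_le hp S n
  have h8 : (1 : ℝ) / 3 ≤ Real.exp (-1) := by
    rw [Real.exp_neg, one_div]
    exact inv_anti₀ (Real.exp_pos _) (by linarith [Real.exp_one_lt_d9])
  rw [le_div_iff₀ (by positivity)]
  have h9 := escape_nonneg hp S
  have h10 : (S : ℝ) * Λ ≤ 6 * scale p S n := by
    refine le_trans ?_ (mul_le_mul_of_nonneg_left hsum (by norm_num))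
    have h11 : (S : ℝ) ≤ 6 * (Real.exp (-1) * (S - 2)) := by nlinarith
    calc (S : ℝ) * Λ ≤ 6 * (Real.exp (-1) * (S - 2)) * Λ := by gcongr
      _ = _ := by ring
  calc escape p S * (S * Λ) ≤ escape p S * (6 * scale p S n) := by gcongr
    _ = 6 * (scale p S n * escape p S) := by ring
    _ ≤ 6 := by linarith

/-- Within distance `R` the odds product is at least `1/16` and the scale at most the distance, so a
harmonic sum of size `log R` cancels the weight. With `log S ≤ 2 log R` and the factor `1/2`, the
constant is `1 / (2 * 2 * 16)`. -/
lemma le_sum_odds_div_scale (hp : Admissible p) {R : ℕ} (hR : 4 ≤ R)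
    (h : ∀ k, R < k → 1 - 2 / (k : ℝ) ≤ odds p k) :
    1 / 64 ≤ ∑ S ∈ Finset.Ioc R (2 * R),
      1 / Real.log S * (1 / 2 * (oddsProd p R (S - R) / scale p R (S - R))) := by
  have hR' : (4 : ℝ) ≤ R := by exact_mod_cast hR
  have hlog : 0 < Real.log R := Real.log_pos (by linarith)
  have hlog2 : Real.log (2 * R) ≤ 2 * Real.log R := by
    rw [Real.log_mul (by norm_num) (by linarith), two_mul]
    gcongr
    linarith
  have hterm : ∀ j ∈ Finset.range R, 1 / (64 * Real.log R) * (1 / (1 + (j : ℝ))) ≤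
      1 / Real.log (R + 1 + j : ℕ) * (1 / 2 * (oddsProd p R (j + 1) / scale p R (j + 1))) := by
    intro j hj
    have hj' : j + 1 ≤ R := Finset.mem_range.1 hj
    have hjR : (j : ℝ) + 1 ≤ R := by exact_mod_cast hj'
    have hj0 : (0 : ℝ) ≤ j := j.cast_nonneg
    have h1 : 1 / 16 ≤ oddsProd p R (j + 1) := by
      refine le_trans ?_ (rpow_le_oddsProd hp (a := 2) (by norm_num) le_rfl (by omega) h (j + 1))
      have h2 : (1 : ℝ) / 4 ≤ ((R : ℝ) - 2) / (R + (j + 1 : ℕ) - 2) := by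
        push_cast
        rw [le_div_iff₀ (by linarith)]
        linarith
      refine le_trans ?_ (Real.rpow_le_rpow (by norm_num) h2 (by norm_num))
      norm_num
    have h2 : scale p R (j + 1) ≤ 1 + j := by
      have := scale_le hp R (j + 1)
      push_cast at this
      linarith
    have h3 : 0 < scale p R (j + 1) := by linarith [one_le_scale hp R (n := j + 1) (by omega)]
    have h4 : 1 / 16 / (1 + (j : ℝ)) ≤ oddsProd p R (j + 1) / scale p R (j + 1) :=
      div_le_div₀ (oddsProd_pos hp _ _).le h1 h3 h2
    have h5 : 0 < Real.log (R + 1 + j : ℕ) := Real.log_pos (by push_cast; linarith)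
    have h6 : Real.log (R + 1 + j : ℕ) ≤ 2 * Real.log R := by
      refine le_trans (Real.log_le_log (by push_cast; linarith) ?_) hlog2
      push_cast
      linarith
    calc 1 / (64 * Real.log R) * (1 / (1 + (j : ℝ)))
        = 1 / (2 * Real.log R) * (1 / 2 * (1 / 16 / (1 + (j : ℝ)))) := by field_simp; norm_num
      _ ≤ _ := by gcongr
  have hre : ∑ S ∈ Finset.Ioc R (2 * R),
      1 / Real.log S * (1 / 2 * (oddsProd p R (S - R) / scale p R (S - R))) =
      ∑ j ∈ Finset.range R, 1 / Real.log (R + 1 + j : ℕ) *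
        (1 / 2 * (oddsProd p R (j + 1) / scale p R (j + 1))) := by
    have : Finset.Ioc R (2 * R) = Finset.Ico (R + 1) (2 * R + 1) := by ext; simp
    rw [this, Finset.sum_Ico_eq_sum_range, show 2 * R + 1 - (R + 1) = R by omega]
    refine Finset.sum_congr rfl fun j _ => ?_
    rw [show R + 1 + j - R = j + 1 by omega]
  rw [hre]
  refine le_trans ?_ (Finset.sum_le_sum hterm)
  rw [← Finset.mul_sum]
  have h7 := log_le_sum_inv one_pos R
  rw [Real.log_one, sub_zero] at h7
  have h8 : Real.log R ≤ ∑ j ∈ Finset.range R, 1 / (1 + (j : ℝ)) :=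
    (Real.log_le_log (by linarith) (by linarith)).trans h7
  calc (1 : ℝ) / 64 = 1 / (64 * Real.log R) * Real.log R := by field_simp
    _ ≤ _ := by gcongr

/-- The slowly varying factor is frozen at `S`, giving the constant coefficient of `1/k` that
`rpow_le_oddsProd` requires. -/
lemma odds_ge_of_le_critDrift (hp : Admissible p) {β : ℝ} (hβ : 0 ≤ β) {S k : ℕ} (hSk : S ≤ k)
    (hS : 1 < Real.log S) (hS1 : 1 ≤ Real.log (Real.log S)) (hk : 1 ≤ k)
    (h : p k ≤ critDrift β k) :
    1 - (1 + 1 / Real.log (Real.log S) ^ β) / k ≤ odds p k := by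
  refine le_trans ?_ (one_sub_le_odds hp hk)
  have h1 := log_log_mono hS hSk
  have hk' : (0 : ℝ) < k := by exact_mod_cast hk
  have h2 : 0 < Real.log (Real.log S) ^ β := Real.rpow_pos_of_pos (by linarith) _
  have h3 : Real.log (Real.log S) ^ β ≤ Real.log (Real.log k) ^ β :=
    Real.rpow_le_rpow (by linarith) h1 hβ
  have h4 : 4 * critDrift β k = (1 + 1 / Real.log (Real.log k) ^ β) / k := by
    unfold critDrift
    have h5 := h2.trans_le h3
    field_simp
  have h6 : (1 + 1 / Real.log (Real.log k) ^ β) / (k : ℝ) ≤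
      (1 + 1 / Real.log (Real.log S) ^ β) / k := by gcongr
  linarith

lemma ae_finite_cutpoints {P : Measure (ℕ → ℕ)} [IsProbabilityMeasure P] (hp : Admissible p)
    (hP : IsNNWalk P p fun n x => x n) {β : ℝ} (hβ : 1 < β)
    (h : ∀ᶠ k : ℕ in atTop, p k ≤ critDrift β k) :
    ∀ᵐ x ∂P, {R : ℕ | IsCutpoint x R}.Finite := by
  obtain ⟨N, hN⟩ := eventually_atTop.1 (eventually_large.and h)
  have hodds : ∀ S k, N ≤ S → S < k →
      1 - (1 + 1 / Real.log (Real.log S) ^ β) / k ≤ odds p k := by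
    intro S k hS hk
    obtain ⟨⟨h1, h2, h3, _⟩, _⟩ := hN S hS
    exact odds_ge_of_le_critDrift hp (by linarith) hk.le (by linarith) h3 (by omega)
      (hN k (by omega)).2
  have hL : ∀ S, N ≤ S → 1 ≤ Real.log (Real.log S) ^ β := fun S hS =>
    Real.one_le_rpow (hN S hS).1.2.2.1 (by linarith)
  set w : ℕ → ℝ := fun S => 1 / Real.log S with hw
  have hw0 : ∀ S, 0 ≤ w S := fun S => one_div_nonneg.2 (Real.log_natCast_nonneg S)
  have hsum : Summable fun S => w S * escape p S := by
    refine Summable.of_norm_bounded_eventually_nat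
      ((summable_inv_mul_log_mul_log_log_rpow hβ).mul_left 6) ?_
    filter_upwards [eventually_ge_atTop N] with S hS
    obtain ⟨⟨h1, h2, h3, _⟩, _⟩ := hN S hS
    rw [Real.norm_of_nonneg (mul_nonneg (hw0 S) (escape_nonneg hp S))]
    have h5 := escape_le_of_odds_ge hp (hL S hS) (by omega) fun k hk => hodds S k hS hk
    have h6 : 0 < Real.log S := by linarith
    calc w S * escape p S ≤ w S * (6 / (S * Real.log (Real.log S) ^ β)) :=
          mul_le_mul_of_nonneg_left h5 (hw0 S)
      _ = 6 * (1 / (S * Real.log S * Real.log (Real.log S) ^ β)) := by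
          simp only [hw]
          rw [div_mul_div_comm, one_mul, mul_one_div]
          congr 1
          ring
  set g : ℕ → ENNReal := fun S => ENNReal.ofReal (w S * escape p S) with hg
  have htail := ENNReal.tendsto_sum_nat_add g hsum.tsum_ofReal_ne_top
  have hshift : ∀ a, (∑' S, if a ≤ S then g S else 0) = ∑' k, g (k + a) := by
    intro a
    rw [← Summable.sum_add_tsum_nat_add' (k := a) ENNReal.summable]
    rw [Finset.sum_eq_zero fun i hi => if_neg (by simpa using hi), zero_add]
    exact tsum_congr fun k => if_pos (by omega)
  -- Infinitely many cutpoints entail one beyond every `a`, so the tails of the convergent series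
  -- bound a fixed quantity.
  have hbound : ∀ a, N ≤ a →
      ENNReal.ofReal (1 / 64) * P {x | ¬ {R : ℕ | IsCutpoint x R}.Finite} ≤ ∑' k, g (k + a) := by
    intro a ha
    rw [← hshift a]
    refine le_trans ?_ (measure_exists_cutpoint_le hp hP hw0 (a := a) (c := 1 / 64) ?_)
    · refine mul_le_mul_right (measure_mono fun x hx => ?_) _
      by_contra hne
      refine hx ((Set.finite_lt_nat a).subset fun R hR => ?_)
      by_contra hlt
      exact hne ⟨R, not_lt.1 hlt, (isCutpoint_iff x R).1 hR⟩
    · intro R hR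
      refine le_sum_odds_div_scale hp (by have := (hN R (by omega)).1.1; omega) fun k hk => ?_
      refine le_trans ?_ (hodds R k (by omega) hk)
      have h1 : 1 / Real.log (Real.log R) ^ β ≤ 1 := by
        have := hL R (by omega)
        rw [div_le_one] <;> linarith
      gcongr
      linarith
  have hzero : ENNReal.ofReal (1 / 64) * P {x | ¬ {R : ℕ | IsCutpoint x R}.Finite} ≤ 0 :=
    ge_of_tendsto htail (eventually_atTop.2 ⟨N, hbound⟩)
  rw [ae_iff]
  have := mul_eq_zero.1 (le_antisymm hzero zero_le)
  refine this.resolve_left ?_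
  simp

end SmallDrift

/-! ### Large drifts -/

section LargeDrift

variable {p : ℕ → ℝ}

/-- The odds product is the increment of the scale, so this is a Riemann sum for `∫ ds / s`. The
factor 2 comes from evaluating at the left end, since the increment is at most one and the scale at
least one. -/
lemma sum_oddsProd_div_scale_le (hp : Admissible p) (R : ℕ) {M : ℕ} (hM : 1 ≤ M) :
    ∑ n ∈ Finset.Ico 1 M, oddsProd p R n / scale p R n ≤ 2 * Real.log (scale p R M) := by
  induction M, hM using Nat.le_induction with
  | base => simp [scale_one]
  | succ M hM ih =>
    rw [Finset.sum_Ico_succ_top hM]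
    have h1 := one_le_scale hp R hM
    have h2 := one_le_scale hp R (n := M + 1) (by omega)
    have h3 := sub_div_le_log_sub (a := scale p R M) (b := scale p R (M + 1)) (by linarith)
      (by linarith)
    have h4 : oddsProd p R M / scale p R M ≤
        2 * ((scale p R (M + 1) - scale p R M) / scale p R (M + 1)) := by
      have hρ := oddsProd_pos hp R M
      have hρ1 := oddsProd_le_one hp R M
      rw [scale_succ, add_sub_cancel_left, mul_div_assoc',
        div_le_div_iff₀ (by linarith) (by linarith)]
      nlinarith
    linarith

/-- The odds decrease in the drift; at drift `x / 4`, clearing the denominator leaves the surplus `x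
^ 3 / 8`. -/
lemma odds_le_of_le (hp : Admissible p) {k : ℕ} (hk : 1 ≤ k) {x : ℝ} (hx : 0 ≤ x)
    (h : x / 4 ≤ p k) : odds p k ≤ 1 - x + x ^ 2 / 2 := by
  have h1 := hp k hk
  rw [odds, div_le_iff₀ (hp.pos k), upProb, if_neg (by omega)]
  have h2 : 0 ≤ 1 - x + x ^ 2 / 2 := by nlinarith [sq_nonneg (x - 1)]
  have h3 := mul_le_mul_of_nonneg_left (show 1 / 2 + x / 4 ≤ 1 / 2 + p k by linarith) h2
  nlinarith [pow_nonneg hx 3]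

/-- The recursion `scale_succ'` moves the base from `R` to `R + 1`, so a nonnegative supersolution
dominates every partial sum. -/
lemma scale_le_of_supersolution (hp : Admissible p) {N : ℕ} {f : ℕ → ℝ}
    (hf0 : ∀ R, N ≤ R → 0 ≤ f R)
    (hf : ∀ R, N ≤ R → 1 + odds p (R + 1) * f (R + 1) ≤ f R) (n : ℕ) :
    ∀ R, N ≤ R → scale p R n ≤ f R := by
  induction n with
  | zero => intro R hR; rw [scale_zero]; exact hf0 R hR
  | succ n ih =>
    intro R hR
    rw [scale_succ']
    refine le_trans ?_ (hf R hR)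
    have := ih (R + 1) (by omega)
    have := (odds_pos hp (i := R + 1) (by omega)).le
    gcongr

/-- The factor 4 balances the budget. The critical drift gains `4 (L + 1)` with `L = log log (R +
1)`: `4 L` pays for the step from `R + 1` to `R`, and the remaining 4 covers the added 1, a
second-order error of at most 1, and at most 2 for the change of the iterated logarithm. -/
lemma supersolution_step (hp : Admissible p) {R : ℕ} (hR : 2 ≤ Real.log R)
    (hL1 : 1 ≤ Real.log (Real.log (R + 1 : ℕ))) (h4 : 4 * Real.log (R + 1 : ℕ) ≤ (R + 1 : ℕ))
    (h : critDrift 1 (R + 1) ≤ p (R + 1)) :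
    1 + odds p (R + 1) * (4 * (R + 1 : ℕ) * Real.log (Real.log (R + 1 : ℕ))) ≤
      4 * R * Real.log (Real.log R) := by
  have hR0 : (0 : ℝ) < R := by
    rcases Nat.eq_zero_or_pos R with rfl | h
    · simp at hR; linarith
    · exact_mod_cast h
  have hkR : ((R + 1 : ℕ) : ℝ) = R + 1 := by push_cast; ring
  have hk0 : (0 : ℝ) < (R + 1 : ℕ) := by rw [hkR]; linarith
  have hlogk : Real.log R ≤ Real.log (R + 1 : ℕ) := Real.log_le_log hR0 (by rw [hkR]; linarith)
  have a1 := log_sub_le_sub_div (a := Real.log R) (b := Real.log (R + 1 : ℕ)) (by linarith)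
    (by linarith)
  have a2 := log_sub_le_sub_div hR0 hk0
  have a3 : ((R + 1 : ℕ) : ℝ) - R = 1 := by rw [hkR]; ring
  rw [a3] at a2
  have a4 := Real.log_le_sub_one_of_pos (x := Real.log (R + 1 : ℕ)) (by linarith)
  set k : ℝ := ((R + 1 : ℕ) : ℝ) with hk
  set L := Real.log (Real.log k) with hL
  set x : ℝ := 1 / k + 1 / (k * L) with hx
  have hL0 : 0 < L := by linarith
  have hx0 : 0 ≤ x := by positivity
  have hodds := odds_le_of_le hp (k := R + 1) (by omega) hx0 (le_trans (le_of_eq (by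
    rw [critDrift, Real.rpow_one, ← hk, ← hL, hx]; ring)) h)
  have hkLx : k * L * x = L + 1 := by rw [hx]; field_simp
  have hkx : k * x ≤ 2 := by
    have : k * x = 1 + 1 / L := by rw [hx]; field_simp
    have h1 : 1 / L ≤ 1 := by rw [div_le_one] <;> linarith
    linarith
  -- the loss in the iterated logarithm
  have hloss : R * (L - Real.log (Real.log R)) ≤ 1 / 2 := by
    have h1 : L - Real.log (Real.log R) ≤ 1 / R / 2 := by
      refine a1.trans ?_
      calc _ ≤ 1 / (R : ℝ) / Real.log R := by gcongr
        _ ≤ 1 / R / 2 := by gcongr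
    calc R * (L - Real.log (Real.log R)) ≤ R * (1 / R / 2) := by gcongr
      _ = 1 / 2 := by field_simp
  have hmain : odds p (R + 1) * (4 * k * L) ≤ 4 * k * L - 4 * (L + 1) + 2 * (L + 1) * x := by
    calc odds p (R + 1) * (4 * k * L) ≤ (1 - x + x ^ 2 / 2) * (4 * k * L) := by gcongr
      _ = 4 * k * L - 4 * (k * L * x) + 2 * (k * L * x) * x := by ring
      _ = _ := by rw [hkLx]
  have hsmall : 2 * (L + 1) * x ≤ 1 := by
    have h1 : 4 * (L + 1) ≤ k := by linarith
    nlinarith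
  have : (R : ℝ) = k - 1 := by linarith
  nlinarith

lemma critDrift_one_le {β : ℝ} (hβ : β ≤ 1) {k : ℕ} (hL : 1 ≤ Real.log (Real.log k)) :
    critDrift 1 k ≤ critDrift β k := by
  unfold critDrift
  rcases Nat.eq_zero_or_pos k with rfl | h
  · simp
  · have hk : (0 : ℝ) < k := by exact_mod_cast h
    have h1 := Real.rpow_le_rpow_of_exponent_le hL hβ
    have h2 : 0 < Real.log (Real.log k) ^ β := Real.rpow_pos_of_pos (by linarith) _
    gcongr

lemma ae_infinite_strongCutpoints {P : Measure (ℕ → ℕ)} [IsProbabilityMeasure P]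
    (hp : Admissible p) (hP : IsNNWalk P p fun n x => x n) {β : ℝ} (hβ : β ≤ 1)
    (h : ∀ᶠ k : ℕ in atTop, critDrift β k ≤ p k) :
    ∀ᵐ x ∂P, {R : ℕ | IsStrongCutpoint x R}.Infinite := by
  obtain ⟨N, hN⟩ := eventually_atTop.1 (eventually_large.and h)
  set f : ℕ → ℝ := fun R => 4 * R * Real.log (Real.log R) with hf
  have hscale : ∀ R, N ≤ R → ∀ n, scale p R n ≤ f R := by
    intro R hR n
    refine scale_le_of_supersolution hp (N := N) (fun S hS => ?_) (fun S hS => ?_) n R hR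
    · have := (hN S hS).1.2.2.1
      simp only [hf]
      positivity
    · have h1 := (hN S hS).1
      have h2 := hN (S + 1) (by omega)
      exact supersolution_step hp h1.2.1 h2.1.2.2.1 h2.1.2.2.2
        ((critDrift_one_le hβ h2.1.2.2.1).trans h2.2)
  set w : ℕ → ℝ := fun S => 1 / Real.log S with hw
  have hw0 : ∀ S, 0 ≤ w S := fun S => one_div_nonneg.2 (Real.log_natCast_nonneg S)
  -- The correlations contribute at most `2 log (f R) ≤ 6 log R`, hence 6 after weighting by `1 /
  -- log R`; the site `R` itself adds at most 1.
  have hC : ∀ R b, N ≤ R → w R + ∑ S ∈ Finset.Ico (R + 1) b,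
      w S * (oddsProd p R (S - R) / scale p R (S - R)) ≤ 7 := by
    intro R b hR
    obtain ⟨⟨h1, h2, h3, h4⟩, _⟩ := hN R hR
    have hR0 : (8 : ℝ) ≤ R := by exact_mod_cast h1
    have hwR : w R ≤ 1 := by simp only [hw]; rw [div_le_one] <;> linarith
    rcases Nat.lt_or_ge R b with hb | hb
    · have h5 : ∑ S ∈ Finset.Ico (R + 1) b, w S * (oddsProd p R (S - R) / scale p R (S - R)) ≤
          w R * ∑ n ∈ Finset.Ico 1 (b - R), oddsProd p R n / scale p R n := by
        rw [Finset.mul_sum]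
        have h6 := Finset.sum_Ico_add' (fun S => w R * (oddsProd p R (S - R) / scale p R (S - R)))
          1 (b - R) R
        simp only [Nat.add_sub_cancel] at h6
        rw [h6, Nat.sub_add_cancel hb.le, add_comm 1 R]
        refine Finset.sum_le_sum fun S hS => ?_
        have hS' : (R : ℝ) ≤ S := by
          have := (Finset.mem_Ico.1 hS).1
          exact_mod_cast (show R ≤ S by omega)
        refine mul_le_mul_of_nonneg_right ?_
          (div_nonneg (oddsProd_pos hp _ _).le (scale_nonneg hp _ _))
        exact one_div_le_one_div_of_le (by linarith) (Real.log_le_log (by linarith) hS')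
      have h7 := sum_oddsProd_div_scale_le hp R (M := b - R) (by omega)
      have h8 : Real.log (scale p R (b - R)) ≤ 3 * Real.log R := by
        have h9 := one_le_scale hp R (n := b - R) (by omega)
        have h10 : f R ≤ (R : ℝ) ^ 3 := by
          have h11 : Real.log (Real.log R) ≤ R := by
            have := Real.log_le_sub_one_of_pos (x := Real.log R) (by linarith)
            linarith
          calc f R ≤ R * R * R := by simp only [hf]; gcongr; linarith
            _ = (R : ℝ) ^ 3 := by ring
        have h12 := Real.log_le_log (by linarith) ((hscale R hR (b - R)).trans h10)
        rw [Real.log_pow] at h12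
        exact_mod_cast h12
      have h13 : w R * (6 * Real.log R) = 6 := by simp only [hw]; field_simp
      have h14 := mul_le_mul_of_nonneg_left (h7.trans (by linarith : _ ≤ 6 * Real.log R)) (hw0 R)
      linarith
    · rw [Finset.Ico_eq_empty (by omega), Finset.sum_empty]
      linarith
  -- Increments of `log log log` make the sum telescope; `1/8` is `1/2` from `upProb` times `1/4`
  -- from `f`.
  have hlow : ∀ S, N ≤ S → 1 / 8 * (Real.log (Real.log (Real.log (S + 1 : ℕ))) -
      Real.log (Real.log (Real.log S))) ≤ w S * (upProb p S * escape p S) := by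
    intro S hS
    obtain ⟨⟨h1, h2, h3, h4⟩, _⟩ := hN S hS
    obtain ⟨⟨_, k2, k3, _⟩, _⟩ := hN (S + 1) (by omega)
    have hS0 : (0 : ℝ) < S := by exact_mod_cast (show 0 < S by omega)
    have a1 := log_sub_le_sub_div hS0 (b := (S + 1 : ℕ)) (by positivity)
    have a2 := log_sub_le_sub_div (a := Real.log S) (b := Real.log (S + 1 : ℕ)) (by linarith)
      (by linarith)
    have a3 := log_sub_le_sub_div (a := Real.log (Real.log S))
      (b := Real.log (Real.log (S + 1 : ℕ))) (by linarith) (by linarith)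
    have a4 : ((S + 1 : ℕ) : ℝ) - S = 1 := by push_cast; ring
    rw [a4] at a1
    have h5 := inv_le_escape hp (hscale S hS)
    have h6 : Real.log (Real.log (Real.log (S + 1 : ℕ))) - Real.log (Real.log (Real.log S)) ≤
        1 / S / Real.log S / Real.log (Real.log S) := by
      refine a3.trans ?_
      gcongr
      refine a2.trans ?_
      gcongr
    have h7 : 1 / 2 * (f S)⁻¹ ≤ upProb p S * escape p S := by
      have : 0 ≤ (f S)⁻¹ := by simp only [hf]; positivity
      exact mul_le_mul (hp.half_le S) h5 this (hp.pos S).le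
    calc _ ≤ 1 / 8 * (1 / S / Real.log S / Real.log (Real.log S)) := by gcongr
      _ = w S * (1 / 2 * (f S)⁻¹) := by simp only [hw, hf]; field_simp; norm_num
      _ ≤ _ := mul_le_mul_of_nonneg_left h7 (hw0 S)
  have hsum : ∀ a b, N ≤ a → a ≤ b → 1 / 8 * (Real.log (Real.log (Real.log b)) -
      Real.log (Real.log (Real.log a))) ≤
        ∑ S ∈ Finset.Ico a b, w S * (upProb p S * escape p S) := by
    intro a b ha hab
    induction b, hab using Nat.le_induction with
    | base => simp
    | succ b hab ih =>
      rw [Finset.sum_Ico_succ_top hab]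
      linarith [hlow b (by omega)]
  have hlim : Tendsto (fun b : ℕ => Real.log (Real.log (Real.log b))) atTop atTop :=
    Real.tendsto_log_atTop.comp log_log_nat_tendsto
  have hone : ∀ a, N ≤ a → ∀ᵐ x ∂P, ∃ R, a ≤ R ∧ x ∈ cutSet strongArrival R := by
    intro a ha
    set E := {x : ℕ → ℕ | ∃ R, a ≤ R ∧ x ∈ cutSet strongArrival R} with hE
    have hEm : MeasurableSet E := by
      have : E = ⋃ R, ⋃ _ : a ≤ R, cutSet strongArrival R := by
        ext x; simp [hE]
      rw [this]
      exact MeasurableSet.iUnion fun R => MeasurableSet.iUnion fun _ =>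
        isArrival_strong.measurableSet_cutSet R
    have hE1 : P.real E ≤ 1 := measureReal_le_one
    have hPE : 1 ≤ P.real E := by
      by_contra hlt
      rw [not_le] at hlt
      -- The outer 8 cancels the `1/8` of `hsum`, so `Λ (1 - P.real E) ≥ 8`, whereas the moment
      -- bound gives at most `7 * P.real E ≤ 7`.
      obtain ⟨b, hb1, hb2⟩ := ((hlim.eventually_ge_atTop
        (Real.log (Real.log (Real.log a)) + 8 * (8 / (1 - P.real E)))).and
        (eventually_ge_atTop a)).exists
      have h1 := hsum a b ha hb2
      have h2 := le_measure_exists_strongCutpoint hp hP hw0 (a := a) (b := b)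
        (by have := (hN a ha).1.1; omega) (C := 7) (by norm_num)
        fun R hR => hC R b (ha.trans (Finset.mem_Ico.1 hR).1)
      set Λ := ∑ S ∈ Finset.Ico a b, w S * (upProb p S * escape p S)
      have h3 : 8 / (1 - P.real E) ≤ Λ := by linarith
      rw [div_le_iff₀ (by linarith)] at h3
      nlinarith
    have h2 : P.real E = 1 := le_antisymm hE1 hPE
    rw [Measure.real, ENNReal.toReal_eq_one_iff] at h2
    exact (mem_ae_iff_prob_eq_one hEm).2 h2
  have hall : ∀ᵐ x ∂P, ∀ a, ∃ R, max a N ≤ R ∧ x ∈ cutSet strongArrival R :=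
    ae_all_iff.2 fun a => hone _ (le_max_right a N)
  filter_upwards [hall] with x hx
  refine Set.infinite_of_not_bddAbove ?_
  rintro ⟨B, hB⟩
  obtain ⟨R, hR, hxR⟩ := hx (B + 1)
  have : R ≤ B := hB ((isStrongCutpoint_iff x R).2 hxR)
  have := (le_max_left (B + 1) N).trans hR
  omega

end LargeDrift

/-! ### Transfer from path space to an arbitrary probability space -/

/-- The law of a walk on path space is that of a walk. -/
lemma IsNNWalk.map {Ω : Type*} [MeasurableSpace Ω] {μ : Measure Ω} {p : ℕ → ℝ}
    {X : ℕ → Ω → ℕ} (hX : IsNNWalk μ p X) :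
    IsNNWalk (μ.map fun ω n => X n ω) p fun n x => x n := by
  have hm : Measurable fun ω n => X n ω := measurable_pi_lambda _ hX.measurable
  refine ⟨fun n => measurable_pi_apply n, ?_, fun n x j => ?_⟩
  · exact (ae_map_iff hm.aemeasurable (measurableSet_coord 0 {0})).2 hX.start
  · have h1 : MeasurableSet {y : ℕ → ℕ | ∀ i ≤ n, y i = x i} :=
      IsPast.measurableSet (n := n) fun y z hyz hy i hi => (hyz i hi).symm.trans (hy i hi)
    have h2 : MeasurableSet {y : ℕ → ℕ | (∀ i ≤ n, y i = x i) ∧ y (n + 1) = j} :=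
      h1.inter (measurableSet_coord (n + 1) {j})
    rw [Measure.map_apply hm h1, Measure.map_apply hm h2]
    exact hX.step n x j

end NNWalk

end

theorem corollary5p2 {Ω : Type*} [MeasurableSpace Ω] (μ : Measure Ω) [IsProbabilityMeasure μ]
    (p : ℕ → ℝ) (hp : ∀ i, 1 ≤ i → 0 ≤ p i ∧ p i < 1 / 2)
    (X : ℕ → Ω → ℕ) (hX : NNWalk.IsNNWalk μ p X) (β : ℝ) :
    (1 < β → (∀ᶠ k : ℕ in atTop, p k ≤ NNWalk.critDrift β k) →
      ∀ᵐ ω ∂μ, {R : ℕ | NNWalk.IsCutpoint (fun n => X n ω) R}.Finite) ∧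
    (β ≤ 1 → (∀ᶠ k : ℕ in atTop, NNWalk.critDrift β k ≤ p k) →
      ∀ᵐ ω ∂μ, {R : ℕ | NNWalk.IsStrongCutpoint (fun n => X n ω) R}.Infinite) := by
  have hm : Measurable fun ω n => X n ω := measurable_pi_lambda _ hX.measurable
  have : IsProbabilityMeasure (μ.map fun ω n => X n ω) :=
    Measure.isProbabilityMeasure_map hm.aemeasurable
  exact ⟨fun hβ h => ae_of_ae_map hm.aemeasurable (NNWalk.ae_finite_cutpoints hp hX.map hβ h),
    fun hβ h => ae_of_ae_map hm.aemeasurable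
      (NNWalk.ae_infinite_strongCutpoints hp hX.map hβ h)⟩
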